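/- Equip $\mathbb{R}^d$ with the sup norm, let $B_r(x)$ be the closed ball of radius $r$ about $x$ and $B_1=B_1(0)=[-1,1]^d$. For sets, $\dim$ is Hausdorff dimension. A measure $\mu$ is exact dimensional with $\dim\mu=\alpha$ if $\lim_{r\to 0}\log\mu(B_r(x))/\log r=\alpha$ for $\mu$-a.e. $x$; its upper dimension $\overline{\dim}\,\mu$ is the $\mu$-essential supremum of $x\mapsto\limsup_{r\to 0}\log\mu(B_r(x))/\log r$. Definitions. For a ball $E=B_r(c)$ put $T_E(y)=(y-c)/r$. A miniset of a compact set $X\subseteq\mathbb{R}^d$ is a set $B_1\cap T_E X$ with $E$ a ball; a microset is a limit of minisets in the Hausdorff metric on closed subsets of $B_1$; $X$ is homogeneous if every microset of $X$ is a subset of some miniset of $X$. For a Radon measure $\mu$ on $\mathbb{R}^d$ let $T_x\mu$ and $S_t\mu$ be its push-forwards under $y\mapsto y-x$ and $y\mapsto e^t y$, let $\mu^*=\mu/\mu(B_1)$, let $\mu^\square$ be $\mu$ restricted to $B_1$ and normalized to mass $1$, and put $T_x^*\mu=(T_x\mu)^*$, $S_t^*\mu=(S_t\mu)^*$. An ergodic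 fractal distribution (EFD) is a probability distribution $P$ on the set of Radon measures $\nu$ with $\nu(B_1)=1$ (and $0\in\operatorname{supp}\nu$ for $P$-a.e. $\nu$) that is invariant and ergodic under the flow $(S_t^*)_{t\in\mathbb{R}}$ and quasi-Palm: for every bounded open neighbourhood $U$ of $0$, a measurable set $\mathcal{A}$ is $P$-null if and only if for $P$-a.e. $\nu$ and $\nu$-a.e. $x\in U$ one has $T_x^*\nu\notin\mathcal{A}$. A nonzero Radon measure $\mu$ is a uniformly scaling measure (USM) generating $P$ if for $\mu$-a.e. $x$ the distributions $\frac1T\int_0^T\delta_{(S_tT_x\mu)^\square}\,dt$ converge weak-* as $T\to\infty$, as probability measures on the compact space of probability measures on $B_1$, to the image of $P$ under $\nu\mapsto\nu^\square$. Theorem. Let $C\subseteq[0,1]$ be the Cantor set obtained by removing from $[0,1]$ the open middle interval of proportion $8/20$ and iterating, and let $X=C\times C\subseteq\mathbb{R}^2$. (1) $X$ is homogeneous, and there is a $C^\infty$ map $f:\mathbb{R}^2\to\mathbb{R}$ that is injective on $X$ and satisfies $\dim f(X)<\dim X$. Hence dimension conservation fails for $f$: $\dim f(X)+\dim(X\cap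 f^{-1}(y))<\dim X$ for every $y\in f(X)$. (2) There are a probability measure $\mu$ on $\mathbb{R}^2$, an EFD $P$ and a number $\alpha>1$ such that $\mu$ is a USM generating $P$, $\mu$ and $P$-a.e. $\nu$ are exact dimensional of dimension $\alpha$, and the coordinate projection $\pi(x,y)=x$ is injective on $\operatorname{supp}\mu$. Moreover dimension conservation fails for $\mu$: $\overline{\dim}\,\pi\mu+\overline{\dim}\,\mu_{[z]_\pi}<\alpha=\dim\mu$ for $\mu$-a.e. $z$, where $\mu_{[z]_\pi}$ is the conditional measure of $\mu$ on the fibre $[z]_\pi=\pi^{-1}(\pi(z))$. -/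

import Mathlib

open Set Filter Topology MeasureTheory
open scoped ENNReal ContDiff

noncomputable section

/-! `ℝ^d` is `Fin d → ℝ` with the sup norm, so `Metric.closedBall 0 1` is the cube `[-1,1]^d`. -/

/-! ### Minisets, microsets, homogeneous sets -/

/-- The miniset `B₁ ∩ T_E X` of `X`, where `E` is the closed ball of radius `r` about `c` and
`T_E y = (y - c) / r` is the homothety mapping `E` onto the unit ball `B₁`. -/
def miniset {d : ℕ} (X : Set (Fin d → ℝ)) (c : Fin d → ℝ) (r : ℝ) : Set (Fin d → ℝ) :=
  Metric.closedBall 0 1 ∩ (fun y => r⁻¹ • (y - c)) '' X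

/-- A microset of `X`: a closed subset of `B₁` that is a limit of minisets of `X` in the
Hausdorff metric. -/
def IsMicroset {d : ℕ} (X M : Set (Fin d → ℝ)) : Prop :=
  IsClosed M ∧ M ⊆ Metric.closedBall 0 1 ∧
    ∃ (c : ℕ → Fin d → ℝ) (r : ℕ → ℝ), (∀ n, 0 < r n) ∧
      Tendsto (fun n => Metric.hausdorffEDist (miniset X (c n) (r n)) M) atTop (𝓝 0)

/-- A compact set is homogeneous if each of its microsets is a subset of one of its minisets. -/
def IsHomogeneousSet {d : ℕ} (X : Set (Fin d → ℝ)) : Prop :=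
  IsCompact X ∧ ∀ M, IsMicroset X M → ∃ (c : Fin d → ℝ) (r : ℝ), 0 < r ∧ M ⊆ miniset X c r

/-! ### The Cantor set -/

/-- Stage `n` of the construction of the Cantor set: start from `[0,1]` and remove the open
middle `8/20` of each interval, leaving two intervals of `6/20` of its length. -/
def preCantor : ℕ → Set ℝ
  | 0 => Icc 0 1
  | n + 1 => (fun x => 6 / 20 * x) '' preCantor n ∪ (fun x => 14 / 20 + 6 / 20 * x) '' preCantor n

/-- The Cantor set obtained from `[0,1]` by removing the middle `8/20` and iterating. -/
def cantorC : Set ℝ := ⋂ n, preCantor n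

/-- The product of the Cantor set with itself, in the plane. -/
def cantorSquare : Set (Fin 2 → ℝ) := {p | p 0 ∈ cantorC ∧ p 1 ∈ cantorC}

/-! ### Dimension of measures -/

/-- The quotient `log μ(B_r(x)) / log r`, whose behaviour as `r → 0` is the local dimension. -/
def localDimQuot {E : Type*} [PseudoMetricSpace E] [MeasurableSpace E] (μ : Measure E) (x : E)
    (r : ℝ) : ℝ :=
  Real.log (μ.real (Metric.closedBall x r)) / Real.log r

/-- `μ` is exact dimensional, of dimension `α`. -/
def HasExactDim {E : Type*} [PseudoMetricSpace E] [MeasurableSpace E] (μ : Measure E)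
    (α : ℝ) : Prop :=
  ∀ᵐ x ∂μ, Tendsto (localDimQuot μ x) (𝓝[>] 0) (𝓝 α)

/-- The upper dimension of `μ`: the essential supremum of its upper local dimension. -/
def upperDim {E : Type*} [PseudoMetricSpace E] [MeasurableSpace E] (μ : Measure E) : EReal :=
  essSup (fun x => limsup (fun r => (localDimQuot μ x r : EReal)) (𝓝[>] 0)) μ

/-! ### Translation, scaling and normalization of measures -/

/-- `μ* = μ / μ(B₁)`. -/
def starNorm {d : ℕ} (μ : Measure (Fin d → ℝ)) : Measure (Fin d → ℝ) :=
  (μ (Metric.closedBall 0 1))⁻¹ • μ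

/-- `T_x μ`, the push-forward of `μ` under `y ↦ y - x`. -/
def translateMeas {d : ℕ} (x : Fin d → ℝ) (μ : Measure (Fin d → ℝ)) : Measure (Fin d → ℝ) :=
  μ.map (fun y => y - x)

/-- `S_t μ`, the push-forward of `μ` under `y ↦ e^t y`. -/
def scaleMeas {d : ℕ} (t : ℝ) (μ : Measure (Fin d → ℝ)) : Measure (Fin d → ℝ) :=
  μ.map (fun y => Real.exp t • y)

open Classical in
/-- `μ^□`: the measure `μ` restricted to `B₁` and normalized to mass one, as a probability measure
on `B₁`. (The value is irrelevant where this is undefined, i.e. where `μ(B₁)` is `0` or `∞`.) -/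
def boxNorm {d : ℕ} (μ : Measure (Fin d → ℝ)) :
    ProbabilityMeasure (Metric.closedBall (0 : Fin d → ℝ) 1) :=
  ⟨if IsProbabilityMeasure ((μ (Metric.closedBall 0 1))⁻¹ •
      μ.comap ((↑) : Metric.closedBall (0 : Fin d → ℝ) 1 → Fin d → ℝ)) then
    (μ (Metric.closedBall 0 1))⁻¹ •
      μ.comap ((↑) : Metric.closedBall (0 : Fin d → ℝ) 1 → Fin d → ℝ)
    else Measure.dirac ⟨0, Metric.mem_closedBall_self zero_le_one⟩,
    by split_ifs with h; exacts [h, inferInstance]⟩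

/-! ### Fractal distributions

A distribution is a probability measure on the space of measures, with its σ-algebra generated by
the evaluations `ν ↦ ν A`. -/

/-- `P` is a probability distribution on the set `ℳ*` of Radon measures `ν` with `ν(B₁) = 1`,
concentrated on those `ν` with `0 ∈ supp ν`, where the flow `S*` is defined. -/
def IsDistribution {d : ℕ} (P : Measure (Measure (Fin d → ℝ))) : Prop :=
  IsProbabilityMeasure P ∧ ∀ᵐ ν ∂P,
    IsLocallyFiniteMeasure ν ∧ ν (Metric.closedBall 0 1) = 1 ∧ (0 : Fin d → ℝ) ∈ ν.support

/-- `P` is invariant under the flow `S_t* ν = (S_t ν)*`. -/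
def IsScaleInvariant {d : ℕ} (P : Measure (Measure (Fin d → ℝ))) : Prop :=
  ∀ t : ℝ, MeasurePreserving (fun ν => starNorm (scaleMeas t ν)) P P

/-- `P` is quasi-Palm: for every bounded open neighbourhood `U` of the origin, `P` has the same
null sets as the law of `T_x* ν`, where `ν` is chosen by `P` and then `x ∈ U` by `ν`. -/
def IsQuasiPalm {d : ℕ} (P : Measure (Measure (Fin d → ℝ))) : Prop :=
  ∀ U : Set (Fin d → ℝ), IsOpen U → Bornology.IsBounded U → 0 ∈ U →
    ∀ A : Set (Measure (Fin d → ℝ)), MeasurableSet A →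
      (P A = 0 ↔ ∀ᵐ ν ∂P, ∀ᵐ x ∂(ν.restrict U), starNorm (translateMeas x ν) ∉ A)

/-- Fractal distributions. -/
def IsFD {d : ℕ} (P : Measure (Measure (Fin d → ℝ))) : Prop :=
  IsDistribution P ∧ IsScaleInvariant P ∧ IsQuasiPalm P

/-- Ergodic fractal distributions. -/
def IsEFD {d : ℕ} (P : Measure (Measure (Fin d → ℝ))) : Prop :=
  IsFD P ∧ ∀ A : Set (Measure (Fin d → ℝ)), MeasurableSet A →
    (∀ t : ℝ, P (symmDiff ((fun ν => starNorm (scaleMeas t ν)) ⁻¹' A) A) = 0) →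
      P A = 0 ∨ P A = 1

/-! ### Uniformly scaling measures -/

/-- The scenery `μ_{x,t}^□ = (S_t T_x μ)^□` of `μ` at `x`. -/
def scenery {d : ℕ} (μ : Measure (Fin d → ℝ)) (x : Fin d → ℝ) (t : ℝ) :
    ProbabilityMeasure (Metric.closedBall (0 : Fin d → ℝ) 1) :=
  boxNorm (scaleMeas t (translateMeas x μ))

/-- `μ` generates `P` at `x ∈ supp μ`: as `T → ∞`, the scenery distributions
`(1/T) ∫_0^T δ_{μ_{x,t}^□} dt` converge, in the weak-* topology of the probability measures on
the compact space of probability measures on `B₁`, to the restricted version `P^□` of `P`. -/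
def GeneratesAt {d : ℕ} (μ : Measure (Fin d → ℝ)) (x : Fin d → ℝ)
    (P : Measure (Measure (Fin d → ℝ))) : Prop :=
  x ∈ μ.support ∧
    ∀ F : C(ProbabilityMeasure (Metric.closedBall (0 : Fin d → ℝ) 1), ℝ),
      Tendsto (fun T : ℝ => T⁻¹ * ∫ t in (0 : ℝ)..T, F (scenery μ x t)) atTop
        (𝓝 (∫ ν, F (boxNorm ν) ∂P))

/-- `μ` is a (nonzero, Radon) uniformly scaling measure generating `P`. -/
def IsUSMGenerating {d : ℕ} (μ : Measure (Fin d → ℝ)) (P : Measure (Measure (Fin d → ℝ))) :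
    Prop :=
  IsLocallyFiniteMeasure μ ∧ μ ≠ 0 ∧ ∀ᵐ x ∂μ, GeneratesAt μ x P

/-- The coordinate projection `π(x,y) = x` of the plane. -/
def proj₁ (p : Fin 2 → ℝ) : ℝ := p 0

/-- The conditional measure `μ_{[x]_π}` of `μ` on the fibre of `proj₁` through `x`, given by the
disintegration of `μ` over the σ-algebra generated by `proj₁`. -/
def fibreMeas (μ : Measure (Fin 2 → ℝ)) [IsFiniteMeasure μ] (x : Fin 2 → ℝ) :
    Measure (Fin 2 → ℝ) :=
  ProbabilityTheory.condExpKernel μ (MeasurableSpace.comap proj₁ inferInstance) x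

end

/-!
(1) Since `X = C × C` is self-similar with separated pieces, each of its minisets lies in a miniset
whose radius is between two positive constants. The nonempty minisets with such radii form a compact
family, so a limit of minisets lies in a miniset. Each digit of a coordinate is a locally constant
function on `X`, so it extends to a smooth function with compact support; a series of these
extensions with weights that decrease fast enough converges to a smooth function whose value at a
point of `X` determines all the digits. It maps `X`, of dimension greater than one, injectively into
the line.

(2) Lebesgue measure, normalized, is fixed by scaling, so that its point mass is an ergodic fractal
distribution of dimension two. A measure `μ` generates it while the projection `π` is injective on
its support: choose the binary digits of a point `(x, y)` by independent fair coins, except that the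
digits of `x` at the positions `2 ^ (2 * j)` repeat the `j`-th digit of `y` and those at the
positions `2 ^ (2 * j + 1)` are `0`. So `x` determines `y`, the zeros excluding a second binary
expansion. The modified positions are so sparse that the dimension is still two, and that, seen from
a typical point, the measure looks like Lebesgue measure at all scales outside a set of times of
density zero. By injectivity the conditional measures on the fibres of `π` are point masses, whereas
`π μ` has dimension at most one, as has any locally finite measure on the line.
-/

/-! ### The Cantor set -/

theorem isCompact_preCantor (n : ℕ) : IsCompact (preCantor n) := by
  induction n with
  | zero => exact isCompact_Icc
  | succ n ih => exact (ih.image (by fun_prop)).union (ih.image (by fun_prop))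

theorem isCompact_cantorC : IsCompact cantorC :=
  (isCompact_preCantor 0).of_isClosed_subset
    (isClosed_iInter fun n => (isCompact_preCantor n).isClosed) (iInter_subset preCantor 0)

theorem cantorC_subset_Icc : cantorC ⊆ Icc 0 1 := iInter_subset preCantor 0

theorem preCantor_subset_Icc (n : ℕ) : preCantor n ⊆ Icc 0 1 := by
  induction n with
  | zero => exact subset_rfl
  | succ n ih =>
    rintro _ (⟨x, hx, rfl⟩ | ⟨x, hx, rfl⟩) <;> obtain ⟨hx₀, hx₁⟩ := ih hx <;>
      constructor <;> linarith

/-- The contraction of the line onto the half of the Cantor set with first digit `e`. -/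
noncomputable def cantorBranch (e : Fin 2) (x : ℝ) : ℝ := 14 / 20 * (e : ℕ) + 6 / 20 * x

/-- The first digit of a point `x` of the Cantor set: `0` in the left half, `1` in the right one. -/
noncomputable def firstDigit (x : ℝ) : Fin 2 := if x ≤ 1 / 2 then 0 else 1

/-- The expanding map of the Cantor set, which drops the first digit. -/
noncomputable def cantorShift (x : ℝ) : ℝ := 20 / 6 * x - 14 / 6 * (firstDigit x : ℕ)

theorem firstDigit_cantorBranch (e : Fin 2) {x : ℝ} (hx : x ∈ Icc (0 : ℝ) 1) :
    firstDigit (cantorBranch e x) = e := by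
  obtain ⟨hx₀, hx₁⟩ := hx
  fin_cases e
  · exact if_pos (by norm_num [cantorBranch]; linarith)
  · exact if_neg (by norm_num [cantorBranch]; linarith)

theorem cantorShift_cantorBranch (e : Fin 2) {x : ℝ} (hx : x ∈ Icc (0 : ℝ) 1) :
    cantorShift (cantorBranch e x) = x := by
  rw [cantorShift, firstDigit_cantorBranch e hx, cantorBranch]; ring

theorem mem_preCantor_succ {n : ℕ} {x : ℝ} :
    x ∈ preCantor (n + 1) ↔ ∃ e, ∃ y ∈ preCantor n, cantorBranch e y = x := by
  simp [preCantor, cantorBranch, Fin.exists_fin_two]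

theorem cantorBranch_mem_cantorC (e : Fin 2) {x : ℝ} (hx : x ∈ cantorC) :
    cantorBranch e x ∈ cantorC := by
  have mem_succ (n : ℕ) : cantorBranch e x ∈ preCantor (n + 1) :=
    mem_preCantor_succ.2 ⟨e, x, mem_iInter.1 hx n, rfl⟩
  refine mem_iInter.2 fun n => ?_
  cases n with
  | zero => exact preCantor_subset_Icc 1 (mem_succ 0)
  | succ n => exact mem_succ n

theorem cantorShift_mem_cantorC {x : ℝ} (hx : x ∈ cantorC) : cantorShift x ∈ cantorC := by
  refine mem_iInter.2 fun n => ?_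
  obtain ⟨e, y, hy, rfl⟩ := mem_preCantor_succ.1 (mem_iInter.1 hx (n + 1))
  rwa [cantorShift_cantorBranch e (preCantor_subset_Icc n hy)]

theorem le_half_of_abs_sub_lt {x y : ℝ} (hx : x ∈ cantorC) (hy : y ∈ cantorC)
    (h : |x - y| < 2 / 5) (hx_le : x ≤ 1 / 2) : y ≤ 1 / 2 := by
  by_contra hy_le
  have x_le : x ≤ 6 / 20 := by
    have := (cantorC_subset_Icc (cantorShift_mem_cantorC hx)).2
    simp only [cantorShift, firstDigit, if_pos hx_le, Fin.val_zero, Nat.cast_zero] at this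
    linarith
  have le_y : 14 / 20 ≤ y := by
    have := (cantorC_subset_Icc (cantorShift_mem_cantorC hy)).1
    simp only [cantorShift, firstDigit, if_neg hy_le, Fin.val_one, Nat.cast_one] at this
    linarith
  linarith [(abs_lt.1 h).1]

theorem firstDigit_eq_of_abs_sub_lt {x y : ℝ} (hx : x ∈ cantorC) (hy : y ∈ cantorC)
    (h : |x - y| < 2 / 5) : firstDigit x = firstDigit y := by
  have : x ≤ 1 / 2 ↔ y ≤ 1 / 2 :=
    ⟨le_half_of_abs_sub_lt hx hy h, le_half_of_abs_sub_lt hy hx (by rwa [abs_sub_comm])⟩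
  simp only [firstDigit, this]

theorem abs_sub_eq_of_firstDigit_eq {x y : ℝ} (h : firstDigit x = firstDigit y) :
    |x - y| = 6 / 20 * |cantorShift x - cantorShift y| := by
  have : x - y = 6 / 20 * (cantorShift x - cantorShift y) := by
    rw [cantorShift, cantorShift, h]; ring
  rw [this, abs_mul, abs_of_pos (by norm_num)]

theorem mem_cantorSquare {p : Fin 2 → ℝ} : p ∈ cantorSquare ↔ ∀ i, p i ∈ cantorC := by
  simp [cantorSquare, Fin.forall_fin_two]

theorem cantorSquare_eq_pi : cantorSquare = univ.pi fun _ => cantorC := by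
  ext p
  rw [mem_cantorSquare, mem_univ_pi]

theorem isCompact_cantorSquare : IsCompact cantorSquare := by
  rw [cantorSquare_eq_pi]
  exact isCompact_univ_pi fun _ => isCompact_cantorC

/-! ### Homogeneity -/

section Homogeneity

variable {d : ℕ} {X : Set (Fin d → ℝ)}

theorem mem_miniset {c p : Fin d → ℝ} {r : ℝ} (hr : 0 < r) :
    p ∈ miniset X c r ↔ ‖p‖ ≤ 1 ∧ c + r • p ∈ X := by
  simp only [miniset, mem_inter_iff, mem_closedBall_zero_iff, mem_image]
  refine and_congr_right fun _ => ⟨?_, fun h => ⟨_, h, ?_⟩⟩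
  · rintro ⟨y, hy, rfl⟩
    rwa [smul_inv_smul₀ hr.ne', add_sub_cancel]
  · rw [add_sub_cancel_left, inv_smul_smul₀ hr.ne']

theorem miniset_subset_miniset_of_add_smul_mem {c v : Fin d → ℝ} {r ρ : ℝ} (hr : 0 < r)
    (hρ : 0 < ρ) (h : ∀ p ∈ miniset X c r, v + ρ • (c + r • p) ∈ X) :
    miniset X c r ⊆ miniset X (v + ρ • c) (ρ * r) := by
  intro p hp
  refine (mem_miniset (mul_pos hρ hr)).2 ⟨((mem_miniset hr).1 hp).1, ?_⟩
  rw [add_assoc, mul_smul, ← smul_add]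
  exact h p hp

theorem norm_center_le_of_miniset_nonempty {c : Fin d → ℝ} {r R : ℝ} (hr : 0 < r)
    (hX : X ⊆ Metric.closedBall 0 R) (h : (miniset X c r).Nonempty) : ‖c‖ ≤ R + r := by
  obtain ⟨p, hp⟩ := h
  obtain ⟨hp_norm, hpX⟩ := (mem_miniset hr).1 hp
  calc ‖c‖ = ‖(c + r • p) - r • p‖ := by rw [add_sub_cancel_right]
    _ ≤ ‖c + r • p‖ + ‖r • p‖ := norm_sub_le _ _
    _ ≤ R + r * 1 := by
        rw [norm_smul, Real.norm_of_nonneg hr.le]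
        exact add_le_add (mem_closedBall_zero_iff.1 (hX hpX)) (by gcongr)
    _ = R + r := by rw [mul_one]

theorem exists_tendsto_of_tendsto_hausdorffEDist {E : Type*} [PseudoEMetricSpace E]
    {s : ℕ → Set E} {t : Set E}
    (h : Tendsto (fun n => Metric.hausdorffEDist (s n) t) atTop (𝓝 0)) {p : E} (hp : p ∈ t) :
    ∃ q : ℕ → E, (∀ᶠ n in atTop, q n ∈ s n) ∧ Tendsto q atTop (𝓝 p) := by
  have exists_near (n : ℕ) : ∃ q, Metric.hausdorffEDist (s n) t < ⊤ →
      q ∈ s n ∧ edist q p ≤ Metric.hausdorffEDist (s n) t + (n : ℝ≥0∞)⁻¹ := by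
    by_cases hn : Metric.hausdorffEDist (s n) t < ⊤
    · rw [Metric.hausdorffEDist_comm] at hn ⊢
      obtain ⟨q, hq, hpq⟩ := Metric.exists_edist_lt_of_hausdorffEDist_lt hp
        (ENNReal.lt_add_right hn.ne (ENNReal.inv_ne_zero.2 (ENNReal.natCast_ne_top n)))
      exact ⟨q, fun _ => ⟨hq, edist_comm p q ▸ hpq.le⟩⟩
    · exact ⟨p, fun h => absurd h hn⟩
  choose q hq using exists_near
  have h_finite : ∀ᶠ n in atTop, Metric.hausdorffEDist (s n) t < ⊤ :=
    h.eventually_lt_const ENNReal.zero_lt_top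
  refine ⟨q, h_finite.mono fun n hn => (hq n hn).1, tendsto_iff_edist_tendsto_0.2 ?_⟩
  have h_bound := h.add ENNReal.tendsto_inv_nat_nhds_zero
  rw [add_zero] at h_bound
  exact tendsto_of_tendsto_of_tendsto_of_le_of_le' tendsto_const_nhds h_bound
    (Eventually.of_forall fun _ => zero_le) (h_finite.mono fun n hn => (hq n hn).2)

theorem mem_miniset_of_tendsto (hX : IsClosed X) {c q : ℕ → Fin d → ℝ} {r : ℕ → ℝ}
    {c₀ p : Fin d → ℝ} {r₀ : ℝ} (hr : ∀ n, 0 < r n) (hr₀ : 0 < r₀)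
    (hc_lim : Tendsto c atTop (𝓝 c₀)) (hr_lim : Tendsto r atTop (𝓝 r₀))
    (hq : ∀ᶠ n in atTop, q n ∈ miniset X (c n) (r n)) (hq_lim : Tendsto q atTop (𝓝 p)) :
    p ∈ miniset X c₀ r₀ := by
  have hq' := hq.mono fun n hn => (mem_miniset (hr n)).1 hn
  exact (mem_miniset hr₀).2 ⟨le_of_tendsto hq_lim.norm (hq'.mono fun _ h => h.1),
    hX.mem_of_tendsto (hc_lim.add (hr_lim.smul hq_lim)) (hq'.mono fun _ h => h.2)⟩

-- The centres and radii of the larger minisets range over a compact set, so a subsequence of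
-- them converges to a miniset that contains the limit.
theorem isHomogeneousSet_of_forall_exists_miniset_subset {a b : ℝ} (hX : IsCompact X)
    (ha : 0 < a) (h : ∀ c r, 0 < r → ∃ c' r', r' ∈ Icc a b ∧ miniset X c r ⊆ miniset X c' r') :
    IsHomogeneousSet X := by
  refine ⟨hX, fun M ⟨_, _, c, r, hr, hlim⟩ => ?_⟩
  rcases M.eq_empty_or_nonempty with rfl | hM
  · exact ⟨0, 1, one_pos, empty_subset _⟩
  choose c' r' hr' hsub using fun n => h (c n) (r n) (hr n)
  have r'_pos (n : ℕ) : 0 < r' n := ha.trans_le (hr' n).1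
  obtain ⟨R, hR⟩ := hX.isBounded.subset_closedBall (0 : Fin d → ℝ)
  have h_mem : ∀ᶠ n in atTop, (c' n, r' n) ∈ Metric.closedBall 0 (R + b) ×ˢ Icc a b := by
    filter_upwards [hlim.eventually_lt_const ENNReal.zero_lt_top] with n hn
    rw [Metric.hausdorffEDist_comm] at hn
    have h_nonempty := (Metric.nonempty_of_hausdorffEDist_ne_top hM hn.ne).mono (hsub n)
    exact ⟨mem_closedBall_zero_iff.2 ((norm_center_le_of_miniset_nonempty (r'_pos n) hR
      h_nonempty).trans (add_le_add_right (hr' n).2 R)), hr' n⟩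
  obtain ⟨⟨c₀, r₀⟩, ⟨_, hr₀⟩, φ, hφ, hconv⟩ :=
    ((isCompact_closedBall _ _).prod isCompact_Icc).tendsto_subseq' h_mem.frequently
  have r₀_pos : 0 < r₀ := ha.trans_le hr₀.1
  refine ⟨c₀, r₀, r₀_pos, fun p hp => ?_⟩
  obtain ⟨q, hq, hq_lim⟩ :=
    exists_tendsto_of_tendsto_hausdorffEDist (hlim.comp hφ.tendsto_atTop) hp
  exact mem_miniset_of_tendsto hX.isClosed (fun n => r'_pos (φ n)) r₀_pos
    ((continuous_fst.tendsto _).comp hconv) ((continuous_snd.tendsto _).comp hconv)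
    (hq.mono fun n hn => hsub (φ n) hn) hq_lim

end Homogeneity

theorem forall_pos_of_forall_mul {P : ℝ → Prop} {b ρ : ℝ} (hb : 0 < b) (hρ : 0 < ρ) (hρ1 : ρ < 1)
    (base : ∀ r ∈ Icc (ρ * b) b, P r) (shrink : ∀ r, b < r → P (ρ * r) → P r)
    (expand : ∀ r, 0 < r → r < ρ * b → P (ρ⁻¹ * r) → P r) {r : ℝ} (hr : 0 < r) : P r := by
  have of_ge (n : ℕ) : ∀ r, ρ * b ≤ r → ρ ^ n * r ≤ b → P r := by
    induction n with
    | zero => exact fun r h₁ h₂ => base r ⟨h₁, by simpa using h₂⟩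
    | succ n ih =>
      intro r h₁ h₂
      rcases le_or_gt r b with h | h
      · exact base r ⟨h₁, h⟩
      · exact shrink r h (ih _ (by gcongr) (by rwa [← mul_assoc, ← pow_succ]))
  have of_le (n : ℕ) : ∀ r, 0 < r → r ≤ b → ρ ^ n * (ρ * b) ≤ r → P r := by
    induction n with
    | zero => exact fun r _ h₁ h₂ => base r ⟨by simpa using h₂, h₁⟩
    | succ n ih =>
      intro r h₀ h₁ h₂
      rcases le_or_gt (ρ * b) r with h | h
      · exact base r ⟨h, h₁⟩
      · refine expand r h₀ h (ih _ (by positivity) ?_ ?_)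
        · rw [inv_mul_le_iff₀ hρ]; exact h.le
        · rw [le_inv_mul_iff₀ hρ, ← mul_assoc, ← pow_succ']; exact h₂
  rcases le_or_gt r b with h | h
  · obtain ⟨n, hn⟩ := exists_pow_lt_of_lt_one (div_pos hr (mul_pos hρ hb)) hρ1
    exact of_le n r hr h ((lt_div_iff₀ (mul_pos hρ hb)).1 hn).le
  · obtain ⟨n, hn⟩ := exists_pow_lt_of_lt_one (div_pos hb hr) hρ1
    exact of_ge n r ((mul_le_of_le_one_left hb.le hρ1.le).trans h.le)
      ((lt_div_iff₀ hr).1 hn).le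

theorem exists_miniset_cantorSquare_subset_shrink (c : Fin 2 → ℝ) {r : ℝ} (hr : 0 < r) :
    ∃ c', miniset cantorSquare c r ⊆ miniset cantorSquare c' (6 / 20 * r) := by
  refine ⟨_, miniset_subset_miniset_of_add_smul_mem (v := 0) hr (by norm_num) fun p hp => ?_⟩
  rw [mem_cantorSquare]
  intro i
  have := cantorBranch_mem_cantorC 0 (mem_cantorSquare.1 ((mem_miniset hr).1 hp).2 i)
  simpa only [cantorBranch, Fin.val_zero, Nat.cast_zero, mul_zero, Pi.add_apply, Pi.smul_apply,
    Pi.zero_apply, smul_eq_mul] using this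

-- A ball of radius less than `1 / 5` meets only one of the four pieces of the square.
theorem exists_miniset_cantorSquare_subset_expand (c : Fin 2 → ℝ) {r : ℝ} (hr : 0 < r)
    (hr_lt : r < 1 / 5) :
    ∃ c', miniset cantorSquare c r ⊆ miniset cantorSquare c' ((6 / 20 : ℝ)⁻¹ * r) := by
  rcases (miniset cantorSquare c r).eq_empty_or_nonempty with h | ⟨q, hq⟩
  · exact ⟨0, h ▸ empty_subset _⟩
  have mem_cantorC {p : Fin 2 → ℝ} (hp : p ∈ miniset cantorSquare c r) (i : Fin 2) :=
    mem_cantorSquare.1 ((mem_miniset hr).1 hp).2 i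
  refine ⟨_, miniset_subset_miniset_of_add_smul_mem
    (v := fun i => -(14 / 6 * ((firstDigit ((c + r • q) i) : ℕ) : ℝ))) hr (by norm_num)
    fun p hp => mem_cantorSquare.2 fun i => ?_⟩
  have h_dist : |(c + r • p) i - (c + r • q) i| < 2 / 5 := by
    have hp_le := (norm_le_pi_norm p i).trans ((mem_miniset hr).1 hp).1
    have hq_le := (norm_le_pi_norm q i).trans ((mem_miniset hr).1 hq).1
    calc |(c + r • p) i - (c + r • q) i| = r * |p i - q i| := by
          rw [← abs_of_pos hr, ← abs_mul, abs_of_pos hr]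
          simp only [Pi.add_apply, Pi.smul_apply, smul_eq_mul]
          ring_nf
      _ ≤ r * (1 + 1) := by gcongr; exact (abs_sub _ _).trans (add_le_add hp_le hq_le)
      _ < 2 / 5 := by linarith
  have := cantorShift_mem_cantorC (mem_cantorC hp i)
  rw [cantorShift, firstDigit_eq_of_abs_sub_lt (mem_cantorC hp i) (mem_cantorC hq i) h_dist] at this
  convert this using 1
  rw [Pi.add_apply, Pi.smul_apply, smul_eq_mul]
  ring

theorem exists_miniset_cantorSquare_subset (c : Fin 2 → ℝ) {r : ℝ} (hr : 0 < r) :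
    ∃ c' r', r' ∈ Icc (1 / 5 : ℝ) (2 / 3) ∧
      miniset cantorSquare c r ⊆ miniset cantorSquare c' r' := by
  refine forall_pos_of_forall_mul (b := 2 / 3) (ρ := 6 / 20) (P := fun r => ∀ c, ∃ c' r',
    r' ∈ Icc (1 / 5 : ℝ) (2 / 3) ∧ miniset cantorSquare c r ⊆ miniset cantorSquare c' r')
    (by norm_num) (by norm_num) (by norm_num) ?_ ?_ ?_ hr c
  · exact fun r hr c => ⟨c, r, by norm_num at hr ⊢; exact hr, subset_rfl⟩
  · intro r hr ih c
    obtain ⟨c₁, hc₁⟩ := exists_miniset_cantorSquare_subset_shrink c (r := r) (by linarith)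
    obtain ⟨c₂, r₂, hr₂, hc₂⟩ := ih c₁
    exact ⟨c₂, r₂, hr₂, hc₁.trans hc₂⟩
  · intro r hr hr_lt ih c
    obtain ⟨c₁, hc₁⟩ := exists_miniset_cantorSquare_subset_expand c hr (by linarith)
    obtain ⟨c₂, r₂, hr₂, hc₂⟩ := ih c₁
    exact ⟨c₂, r₂, hr₂, hc₁.trans hc₂⟩

theorem isHomogeneousSet_cantorSquare : IsHomogeneousSet cantorSquare :=
  isHomogeneousSet_of_forall_exists_miniset_subset isCompact_cantorSquare (by norm_num)
    fun c _ hr => exists_miniset_cantorSquare_subset c hr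

/-! ### Hausdorff dimension of the Cantor square -/

/-- The `n`-th digit of a point of the Cantor set. -/
noncomputable def cantorDigit (x : ℝ) (n : ℕ) : Fin 2 := firstDigit (cantorShift^[n] x)

theorem iterate_cantorShift_mem_cantorC {x : ℝ} (hx : x ∈ cantorC) (n : ℕ) :
    cantorShift^[n] x ∈ cantorC :=
  MapsTo.iterate (fun _ => cantorShift_mem_cantorC) n hx

theorem abs_sub_eq_of_cantorDigit_eq {x y : ℝ} {n : ℕ}
    (h : ∀ i < n, cantorDigit x i = cantorDigit y i) :
    |x - y| = (6 / 20) ^ n * |cantorShift^[n] x - cantorShift^[n] y| := by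
  induction n with
  | zero => simp
  | succ n ih =>
    rw [ih fun i hi => h i (hi.trans n.lt_succ_self), Function.iterate_succ_apply',
      Function.iterate_succ_apply', abs_sub_eq_of_firstDigit_eq (h n n.lt_succ_self), pow_succ,
      mul_assoc]

theorem injOn_cantorDigit : InjOn cantorDigit cantorC := by
  intro x hx y hy hxy
  have abs_sub_le (n : ℕ) : |x - y| ≤ (6 / 20) ^ n := by
    rw [abs_sub_eq_of_cantorDigit_eq fun i (_ : i < n) => congrFun hxy i]
    refine mul_le_of_le_one_right (by positivity) ?_
    obtain ⟨hx₀, hx₁⟩ := cantorC_subset_Icc (iterate_cantorShift_mem_cantorC hx n)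
    obtain ⟨hy₀, hy₁⟩ := cantorC_subset_Icc (iterate_cantorShift_mem_cantorC hy n)
    exact abs_le.2 ⟨by linarith, by linarith⟩
  have abs_sub_le_zero : |x - y| ≤ 0 := ge_of_tendsto'
    (tendsto_pow_atTop_nhds_zero_of_lt_one (by norm_num) (by norm_num)) abs_sub_le
  exact sub_eq_zero.1 (abs_nonpos_iff.1 abs_sub_le_zero)

theorem le_abs_sub_of_cantorDigit_ne {x y : ℝ} (hx : x ∈ cantorC) (hy : y ∈ cantorC) {n : ℕ}
    (h : ∀ i < n, cantorDigit x i = cantorDigit y i) (hn : cantorDigit x n ≠ cantorDigit y n) :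
    2 / 5 * (6 / 20) ^ n ≤ |x - y| := by
  rw [abs_sub_eq_of_cantorDigit_eq h, mul_comm]
  gcongr
  by_contra! hlt
  exact hn (firstDigit_eq_of_abs_sub_lt (iterate_cantorShift_mem_cantorC hx n)
    (iterate_cantorShift_mem_cantorC hy n) hlt)

theorem continuousOn_firstDigit : ContinuousOn firstDigit cantorC := by
  intro x hx
  refine (continuousWithinAt_const (b := firstDigit x)).congr_of_eventuallyEq ?_ rfl
  filter_upwards [self_mem_nhdsWithin, mem_nhdsWithin_of_mem_nhds
    (Metric.ball_mem_nhds x (by norm_num : (0 : ℝ) < 2 / 5))] with y hy hxy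
  exact firstDigit_eq_of_abs_sub_lt hy hx hxy

theorem continuousOn_cantorShift : ContinuousOn cantorShift cantorC :=
  (continuousOn_const.mul continuousOn_id).sub (continuousOn_const.mul
    ((continuous_of_discreteTopology (f := fun e : Fin 2 => ((e : ℕ) : ℝ))).comp_continuousOn
      continuousOn_firstDigit))

theorem continuousOn_cantorDigit (n : ℕ) : ContinuousOn (fun x => cantorDigit x n) cantorC :=
  continuousOn_firstDigit.comp
    (continuousOn_cantorShift.iterate (fun _ => cantorShift_mem_cantorC) n)
    fun _ hx => iterate_cantorShift_mem_cantorC hx n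

theorem exists_forall_lt_cantorDigit_eq (n : ℕ) (e : ℕ → Fin 2) :
    ∃ x ∈ cantorC, ∀ i < n, cantorDigit x i = e i := by
  induction n generalizing e with
  | zero =>
    have zero_mem (n : ℕ) : (0 : ℝ) ∈ preCantor n := by
      induction n with
      | zero => exact ⟨le_rfl, zero_le_one⟩
      | succ n ih => exact Or.inl ⟨0, ih, mul_zero _⟩
    exact ⟨0, mem_iInter.2 zero_mem, fun _ h => absurd h (Nat.not_lt_zero _)⟩
  | succ n ih =>
    obtain ⟨x, hx, hxe⟩ := ih fun i => e (i + 1)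
    refine ⟨cantorBranch (e 0) x, cantorBranch_mem_cantorC _ hx, fun i hi => ?_⟩
    cases i with
    | zero => exact firstDigit_cantorBranch _ (cantorC_subset_Icc hx)
    | succ i =>
      rw [cantorDigit, Function.iterate_succ_apply,
        cantorShift_cantorBranch _ (cantorC_subset_Icc hx)]
      exact hxe i (Nat.succ_lt_succ_iff.1 hi)

theorem exists_cantorDigit_eq (e : ℕ → Fin 2) : ∃ x ∈ cantorC, cantorDigit x = e := by
  let K (n : ℕ) : Set ℝ := cantorC ∩ ⋂ i < n, {x | x ∈ cantorC ∧ cantorDigit x i = e i}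
  have isClosed_digit (i : ℕ) : IsClosed {x | x ∈ cantorC ∧ cantorDigit x i = e i} :=
    (continuousOn_cantorDigit i).preimage_isClosed_of_isClosed isCompact_cantorC.isClosed
      (isClosed_singleton (x := e i))
  have isClosed_K (n : ℕ) : IsClosed (K n) :=
    isCompact_cantorC.isClosed.inter (isClosed_biInter fun i _ => isClosed_digit i)
  obtain ⟨x, hx⟩ := IsCompact.nonempty_iInter_of_sequence_nonempty_isCompact_isClosed K
    (fun n => inter_subset_inter_right _
      (biInter_mono (fun i hi => Nat.lt_succ_of_lt hi) fun _ _ => subset_rfl))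
    (fun n => by
      obtain ⟨x, hx, hxe⟩ := exists_forall_lt_cantorDigit_eq n e
      exact ⟨x, hx, mem_iInter₂.2 fun i hi => ⟨hx, hxe i hi⟩⟩)
    (isCompact_cantorC.of_isClosed_subset (isClosed_K 0) inter_subset_left) isClosed_K
  exact ⟨x, (mem_iInter.1 hx 0).1,
    funext fun n => (mem_iInter₂.1 (mem_iInter.1 hx (n + 1)).2 n n.lt_succ_self).2⟩

-- `5 / 9 < log 2 / log (20 / 6)`, since `(6 / 20) ^ 5 ≥ (1 / 2) ^ 9`.
theorem half_le_rpow : (1 / 2 : ℝ) ≤ (6 / 20) ^ (5 / 9 : ℝ) := by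
  refine le_of_pow_le_pow_left₀ (n := 9) (by norm_num) (by positivity) ?_
  rw [← Real.rpow_natCast (_ ^ _), ← Real.rpow_mul (by norm_num)]
  norm_num

theorem half_pow_le_rpow_of_le {x : ℝ} {n : ℕ} (h : 2 / 5 * (6 / 20) ^ n ≤ x) :
    (1 / 2) ^ n ≤ 5 / 2 * x ^ (5 / 9 : ℝ) := by
  have two_fifths_le : (2 / 5 : ℝ) ≤ (2 / 5) ^ (5 / 9 : ℝ) :=
    Real.self_le_rpow_of_le_one (by norm_num) (by norm_num) (by norm_num)
  calc (1 / 2 : ℝ) ^ n = 5 / 2 * (2 / 5 * (1 / 2) ^ n) := by ring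
    _ ≤ 5 / 2 * ((2 / 5) ^ (5 / 9 : ℝ) * ((6 / 20) ^ (5 / 9 : ℝ)) ^ n) := by
        gcongr; exact half_le_rpow
    _ = 5 / 2 * (2 / 5 * (6 / 20) ^ n) ^ (5 / 9 : ℝ) := by
        rw [Real.mul_rpow (by norm_num) (by positivity), Real.rpow_pow_comm (by norm_num)]
    _ ≤ 5 / 2 * x ^ (5 / 9 : ℝ) := by gcongr

theorem abs_ofDigits_cantorDigit_sub_le {x y : ℝ} (hx : x ∈ cantorC) (hy : y ∈ cantorC) :
    |Real.ofDigits (cantorDigit x) - Real.ofDigits (cantorDigit y)| ≤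
      5 / 2 * |x - y| ^ (5 / 9 : ℝ) := by
  by_cases hxy : cantorDigit x = cantorDigit y
  · rw [hxy, sub_self, abs_zero]
    positivity
  · have digits_eq (i : ℕ) (hi : i < PiNat.firstDiff (cantorDigit x) (cantorDigit y)) :
        cantorDigit x i = cantorDigit y i := PiNat.apply_eq_of_lt_firstDiff hi
    refine (Real.abs_ofDigits_sub_ofDigits_le digits_eq).trans ?_
    rw [Nat.cast_ofNat, ← inv_pow, ← one_div]
    exact half_pow_le_rpow_of_le
      (le_abs_sub_of_cantorDigit_ne hx hy digits_eq (PiNat.apply_firstDiff_ne hxy))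

theorem holderOnWith_ofDigits_cantorDigit :
    HolderOnWith (5 / 2) (5 / 9) (fun (p : Fin 2 → ℝ) i => Real.ofDigits (cantorDigit (p i)))
      cantorSquare := by
  intro p hp q hq
  refine edist_pi_le_iff.2 fun i => ?_
  calc edist (Real.ofDigits (cantorDigit (p i))) (Real.ofDigits (cantorDigit (q i)))
      ≤ ENNReal.ofReal (5 / 2 * |p i - q i| ^ (5 / 9 : ℝ)) := by
        rw [edist_dist, Real.dist_eq]
        exact ENNReal.ofReal_le_ofReal (abs_ofDigits_cantorDigit_sub_le
          (mem_cantorSquare.1 hp i) (mem_cantorSquare.1 hq i))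
    _ = ((5 / 2 : NNReal) : ℝ≥0∞) * edist (p i) (q i) ^ ((5 / 9 : NNReal) : ℝ) := by
        rw [ENNReal.ofReal_mul (by norm_num), edist_dist, Real.dist_eq,
          ENNReal.ofReal_rpow_of_nonneg (abs_nonneg _) (by positivity),
          ← ENNReal.ofReal_coe_nnreal]
        norm_num
    _ ≤ ((5 / 2 : NNReal) : ℝ≥0∞) * edist p q ^ ((5 / 9 : NNReal) : ℝ) := by
        gcongr; exact edist_le_pi_edist p q i

theorem Icc_subset_image_ofDigits_cantorDigit :
    Icc 0 1 ⊆ (fun (p : Fin 2 → ℝ) i => Real.ofDigits (cantorDigit (p i))) '' cantorSquare := by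
  intro q hq
  have exists_coord (i : Fin 2) : ∃ x ∈ cantorC, Real.ofDigits (cantorDigit x) = q i := by
    obtain ⟨e, -, he⟩ := Real.ofDigits_SurjOn one_lt_two ⟨hq.1 i, hq.2 i⟩
    obtain ⟨x, hx, rfl⟩ := exists_cantorDigit_eq e
    exact ⟨x, hx, he⟩
  choose p hp hpq using exists_coord
  exact ⟨p, mem_cantorSquare.2 hp, funext hpq⟩

theorem dimH_Icc_zero_one (d : ℕ) : dimH (Icc (0 : Fin d → ℝ) 1) = d := by
  have h : (interior (Icc (0 : Fin d → ℝ) 1)).Nonempty := by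
    rw [← pi_univ_Icc, interior_pi_set finite_univ]
    exact ⟨fun _ => 1 / 2, fun i _ => by simp only [interior_Icc]; norm_num⟩
  rw [Real.dimH_of_nonempty_interior h, Module.finrank_fin_fun]

theorem one_lt_dimH_cantorSquare : 1 < dimH cantorSquare := by
  have two_le : 2 ≤ dimH cantorSquare / ((5 / 9 : NNReal) : ℝ≥0∞) :=
    calc (2 : ℝ≥0∞) = dimH (Icc (0 : Fin 2 → ℝ) 1) := by rw [dimH_Icc_zero_one, Nat.cast_ofNat]
      _ ≤ _ := dimH_mono Icc_subset_image_ofDigits_cantorDigit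
      _ ≤ _ := holderOnWith_ofDigits_cantorDigit.dimH_image_le (by norm_num)
  calc (1 : ℝ≥0∞) < ((2 * (5 / 9) : NNReal) : ℝ≥0∞) := by
        rw [ENNReal.one_lt_coe_iff, ← NNReal.coe_lt_coe]; norm_num
    _ = 2 * ((5 / 9 : NNReal) : ℝ≥0∞) := by rw [ENNReal.coe_mul, ENNReal.coe_ofNat]
    _ ≤ dimH cantorSquare := ENNReal.mul_le_of_le_div two_le

/-! ### A smooth function that is injective on the Cantor square -/

/-- A sequence of positive weights in which each term dominates the sum of all the later ones,
whatever `0`-`1` coefficients these carry. -/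
structure RapidlyDecreasing (r : ℕ → ℝ) : Prop where
  pos : ∀ n, 0 < r n
  succ_le : ∀ n, r (n + 1) ≤ r n / 3

namespace RapidlyDecreasing

variable {r a b : ℕ → ℝ}

theorem add_le (hr : RapidlyDecreasing r) (n k : ℕ) : r (n + k) ≤ r n * (1 / 3) ^ k := by
  induction k with
  | zero => simp
  | succ k ih => rw [← add_assoc, pow_succ]; linarith [hr.succ_le (n + k)]

theorem norm_add_mul_le (hr : RapidlyDecreasing r) (ha : ∀ n, |a n| ≤ 1) (n k : ℕ) :
    ‖r (n + k) * a (n + k)‖ ≤ r n * (1 / 3) ^ k := by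
  rw [norm_mul, Real.norm_of_nonneg (hr.pos _).le, Real.norm_eq_abs]
  exact (mul_le_of_le_one_right (hr.pos _).le (ha _)).trans (hr.add_le n k)

theorem summable_mul (hr : RapidlyDecreasing r) (ha : ∀ n, |a n| ≤ 1) :
    Summable fun n => r n * a n :=
  .of_norm_bounded
    ((summable_geometric_of_lt_one (by norm_num) (by norm_num : (1 / 3 : ℝ) < 1)).mul_left (r 0))
    fun n => by simpa only [zero_add] using hr.norm_add_mul_le ha 0 n

theorem tsum_mul_ne_zero (hr : RapidlyDecreasing r) (ha : ∀ n, |a n| ≤ 1) {m : ℕ}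
    (hlt : ∀ n < m, a n = 0) (hm : |a m| = 1) : ∑' n, r n * a n ≠ 0 := by
  intro h_zero
  rw [← (hr.summable_mul ha).sum_add_tsum_nat_add (m + 1), Finset.sum_range_succ,
    Finset.sum_eq_zero fun i hi => by rw [hlt i (Finset.mem_range.1 hi), mul_zero],
    zero_add] at h_zero
  have h_tail : ‖∑' n, r (n + (m + 1)) * a (n + (m + 1))‖ ≤ r (m + 1) * (1 - 1 / 3)⁻¹ := by
    refine tsum_of_norm_bounded
      ((hasSum_geometric_of_lt_one (by norm_num) (by norm_num)).mul_left _) fun n => ?_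
    rw [add_comm n]
    exact hr.norm_add_mul_le ha (m + 1) n
  have h_term : ‖r m * a m‖ = r m := by
    rw [norm_mul, Real.norm_of_nonneg (hr.pos m).le, Real.norm_eq_abs, hm, mul_one]
  have r_le : r m ≤ r (m + 1) * (1 - 1 / 3)⁻¹ := by
    rwa [← h_term, eq_neg_of_add_eq_zero_left h_zero, norm_neg]
  norm_num at r_le
  linarith [hr.pos m, hr.succ_le m]

theorem eq_of_tsum_mul_eq (hr : RapidlyDecreasing r) (ha : ∀ n, a n = 0 ∨ a n = 1)
    (hb : ∀ n, b n = 0 ∨ b n = 1) (h : ∑' n, r n * a n = ∑' n, r n * b n) : a = b := by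
  have abs_le_one {c : ℕ → ℝ} (hc : ∀ n, c n = 0 ∨ c n = 1) (n : ℕ) : |c n| ≤ 1 := by
    rcases hc n with h | h <;> simp [h]
  have abs_sub_le_one (n : ℕ) : |a n - b n| ≤ 1 := by
    rcases ha n with h | h <;> rcases hb n with h' | h' <;> simp [h, h']
  have abs_sub_eq_one {n : ℕ} (hn : a n ≠ b n) : |a n - b n| = 1 := by
    rcases ha n with h | h <;> rcases hb n with h' | h' <;> simp [h, h'] at hn ⊢
  by_contra hne
  refine hr.tsum_mul_ne_zero abs_sub_le_one
    (fun n hn => sub_eq_zero.2 (PiNat.apply_eq_of_lt_firstDiff (E := fun _ => ℝ) hn))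
    (abs_sub_eq_one (PiNat.apply_firstDiff_ne (E := fun _ => ℝ) hne)) ?_
  simp only [mul_sub]
  rw [(hr.summable_mul (abs_le_one ha)).tsum_sub (hr.summable_mul (abs_le_one hb)), h, sub_self]

end RapidlyDecreasing

theorem exists_rapidlyDecreasing_mul_le (M : ℕ → ℝ) :
    ∃ r, RapidlyDecreasing r ∧ ∀ n, r n * M n ≤ (1 / 3) ^ n := by
  let q (n : ℕ) : ℝ := (3 * max 1 (M n))⁻¹
  have q_pos (n : ℕ) : 0 < q n := by positivity
  have q_le (n : ℕ) : q n ≤ 1 / 3 := by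
    rw [one_div]
    exact inv_anti₀ (by norm_num) (le_mul_of_one_le_right (by norm_num) (le_max_left _ _))
  have q_mul_le (n : ℕ) : q n * M n ≤ 1 := by
    rw [inv_mul_le_one₀ (by positivity)]
    linarith [le_max_right 1 (M n), le_max_left 1 (M n)]
  refine ⟨fun n => ∏ i ∈ Finset.range (n + 1), q i,
    ⟨fun n => Finset.prod_pos fun i _ => q_pos i, fun n => ?_⟩, fun n => ?_⟩
  · rw [Finset.prod_range_succ _ (n + 1), div_eq_mul_one_div]
    exact mul_le_mul_of_nonneg_left (q_le _) (Finset.prod_nonneg fun i _ => (q_pos i).le)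
  · calc (∏ i ∈ Finset.range (n + 1), q i) * M n
        = (∏ i ∈ Finset.range n, q i) * (q n * M n) := by rw [Finset.prod_range_succ, mul_assoc]
      _ ≤ (∏ i ∈ Finset.range n, q i) * 1 :=
          mul_le_mul_of_nonneg_left (q_mul_le n) (Finset.prod_nonneg fun i _ => (q_pos i).le)
      _ ≤ ∏ _i ∈ Finset.range n, (1 / 3 : ℝ) := by
          rw [mul_one]
          exact Finset.prod_le_prod (fun i _ => (q_pos i).le) fun i _ => q_le i
      _ = (1 / 3) ^ n := by rw [Finset.prod_const, Finset.card_range]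

section ContDiff

variable {E : Type*} [NormedAddCommGroup E] [NormedSpace ℝ E]

theorem exists_norm_iteratedFDeriv_le {F : E → ℝ} (hF : ContDiff ℝ ∞ F) (hc : HasCompactSupport F)
    (n : ℕ) : ∃ M, ∀ k ≤ n, ∀ x, ‖iteratedFDeriv ℝ k F x‖ ≤ M := by
  have exists_bound (k : ℕ) : ∃ R, ∀ x, ‖iteratedFDeriv ℝ k F x‖ ≤ R := by
    obtain ⟨R, hR⟩ := Continuous.bddAbove_range_of_hasCompactSupport
      (hF.continuous_iteratedFDeriv (mod_cast le_top)).norm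
      ((hc.iteratedFDeriv k).comp_left norm_zero)
    exact ⟨R, fun x => hR (mem_range_self x)⟩
  choose R hR using exists_bound
  obtain ⟨M, hM⟩ := ((Finset.range (n + 1)).image R).bddAbove
  exact ⟨M, fun k hk x => (hR k x).trans
    (hM (Finset.mem_coe.2 (Finset.mem_image_of_mem R (Finset.mem_range_succ_iff.2 hk))))⟩

theorem exists_rapidlyDecreasing_contDiff_tsum_mul (F : ℕ → E → ℝ) (hF : ∀ n, ContDiff ℝ ∞ (F n))
    (hc : ∀ n, HasCompactSupport (F n)) :
    ∃ r, RapidlyDecreasing r ∧ ContDiff ℝ ∞ fun x => ∑' n, r n * F n x := by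
  choose M hM using fun n => exists_norm_iteratedFDeriv_le (hF n) (hc n) n
  obtain ⟨r, hr, hrM⟩ := exists_rapidlyDecreasing_mul_le M
  refine ⟨r, hr, contDiff_tsum_of_eventually (v := fun _ n => (1 / 3 : ℝ) ^ n)
    (fun n => contDiff_const.mul (hF n))
    (fun _ _ => summable_geometric_of_lt_one (by norm_num) (by norm_num)) fun k _ => ?_⟩
  rw [Nat.cofinite_eq_atTop]
  filter_upwards [eventually_ge_atTop k] with n hn x
  calc ‖iteratedFDeriv ℝ k (fun x => r n * F n x) x‖ = ‖r n • iteratedFDeriv ℝ k (F n) x‖ :=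
        congrArg norm (iteratedFDeriv_const_smul_apply (a := r n)
          ((hF n).of_le (mod_cast le_top)).contDiffAt)
    _ = r n * ‖iteratedFDeriv ℝ k (F n) x‖ := by rw [norm_smul, Real.norm_of_nonneg (hr.pos n).le]
    _ ≤ r n * M n := mul_le_mul_of_nonneg_left (hM n k hn x) (hr.pos n).le
    _ ≤ (1 / 3) ^ n := hrM n

theorem exists_contDiff_injOn {X : Set E} (F : ℕ → E → ℝ) (hF : ∀ n, ContDiff ℝ ∞ (F n))
    (hc : ∀ n, HasCompactSupport (F n)) (h01 : ∀ n, ∀ x ∈ X, F n x = 0 ∨ F n x = 1)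
    (hinj : InjOn (fun x n => F n x) X) : ∃ f : E → ℝ, ContDiff ℝ ∞ f ∧ InjOn f X := by
  obtain ⟨r, hr, hf⟩ := exists_rapidlyDecreasing_contDiff_tsum_mul F hF hc
  exact ⟨_, hf, fun x hx y hy hxy =>
    hinj hx hy (hr.eq_of_tsum_mul_eq (fun n => h01 n x hx) (fun n => h01 n y hy) hxy)⟩

theorem exists_contDiff_zero_one_of_isCompact [FiniteDimensional ℝ E] {s t : Set E}
    (hs : IsCompact s) (ht : IsCompact t) (hd : Disjoint s t) :
    ∃ F : E → ℝ, ContDiff ℝ ∞ F ∧ HasCompactSupport F ∧ EqOn F 0 s ∧ EqOn F 1 t := by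
  obtain ⟨R, hR⟩ := ht.isBounded.subset_ball 0
  have disjoint_compl : Disjoint (s ∪ (Metric.ball 0 R)ᶜ) t :=
    disjoint_union_left.2 ⟨hd, disjoint_compl_left_iff_subset.2 hR⟩
  obtain ⟨F, hF_zero, hF_one, -⟩ := exists_contMDiffMap_zero_one_of_isClosed (n := ⊤)
    (modelWithCornersSelf ℝ E) (hs.isClosed.union Metric.isOpen_ball.isClosed_compl) ht.isClosed
    disjoint_compl
  have hF_support : HasCompactSupport F :=
    .intro (isCompact_closedBall 0 R) fun x hx =>
      hF_zero (Or.inr fun h => hx (Metric.ball_subset_closedBall h))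
  exact ⟨F, F.contMDiff.contDiff, hF_support, hF_zero.mono subset_union_left, hF_one⟩

end ContDiff

theorem isCompact_cantorSquare_digit (i : Fin 2) (n : ℕ) (e : Fin 2) :
    IsCompact {p | p ∈ cantorSquare ∧ cantorDigit (p i) n = e} := by
  have h_cont : ContinuousOn (fun p : Fin 2 → ℝ => cantorDigit (p i) n) cantorSquare :=
    (continuousOn_cantorDigit n).comp (continuous_apply i).continuousOn
      fun p hp => mem_cantorSquare.1 hp i
  exact isCompact_cantorSquare.of_isClosed_subset
    (h_cont.preimage_isClosed_of_isClosed isCompact_cantorSquare.isClosed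
      (isClosed_singleton (x := e))) fun p hp => hp.1

theorem exists_contDiff_eq_cantorDigit (i : Fin 2) (n : ℕ) :
    ∃ F : (Fin 2 → ℝ) → ℝ, ContDiff ℝ ∞ F ∧ HasCompactSupport F ∧
      ∀ p ∈ cantorSquare, F p = ((cantorDigit (p i) n : ℕ) : ℝ) := by
  obtain ⟨F, hF, hc, h_zero, h_one⟩ := exists_contDiff_zero_one_of_isCompact
    (isCompact_cantorSquare_digit i n 0) (isCompact_cantorSquare_digit i n 1)
    (disjoint_left.2 fun p h₀ h₁ => zero_ne_one (h₀.2.symm.trans h₁.2))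
  refine ⟨F, hF, hc, fun p hp => ?_⟩
  by_cases h : cantorDigit (p i) n = 0
  · rw [h_zero ⟨hp, h⟩, h, Fin.val_zero, Nat.cast_zero, Pi.zero_apply]
  · replace h := Fin.eq_one_of_ne_zero _ h
    rw [h_one ⟨hp, h⟩, h, Fin.val_one, Nat.cast_one, Pi.one_apply]

theorem exists_contDiff_injOn_cantorSquare :
    ∃ f : (Fin 2 → ℝ) → ℝ, ContDiff ℝ ∞ f ∧ InjOn f cantorSquare := by
  obtain ⟨e⟩ : Nonempty (ℕ ≃ Fin 2 × ℕ) := nonempty_equiv_of_countable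
  choose F hF hc hF_eq using fun n => exists_contDiff_eq_cantorDigit (e n).1 (e n).2
  refine exists_contDiff_injOn F hF hc (fun n p hp => ?_) fun p hp q hq hpq => ?_
  · rw [hF_eq n p hp]
    generalize cantorDigit (p (e n).1) (e n).2 = digit
    fin_cases digit <;> simp
  · refine funext fun i => injOn_cantorDigit (mem_cantorSquare.1 hp i) (mem_cantorSquare.1 hq i)
      (funext fun n => Fin.val_injective ?_)
    have := congrFun hpq (e.symm (i, n))
    simpa only [hF_eq _ p hp, hF_eq _ q hq, Equiv.apply_symm_apply, Nat.cast_inj] using this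

theorem exists_contDiff_injOn_dimH_lt :
    ∃ f : (Fin 2 → ℝ) → ℝ, ContDiff ℝ ∞ f ∧ InjOn f cantorSquare ∧
      dimH (f '' cantorSquare) < dimH cantorSquare ∧
      ∀ y ∈ f '' cantorSquare,
        dimH (f '' cantorSquare) + dimH (cantorSquare ∩ f ⁻¹' {y}) < dimH cantorSquare := by
  obtain ⟨f, hf, hinj⟩ := exists_contDiff_injOn_cantorSquare
  have dimH_image_lt : dimH (f '' cantorSquare) < dimH cantorSquare :=
    ((dimH_mono (subset_univ _)).trans_eq Real.dimH_univ).trans_lt one_lt_dimH_cantorSquare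
  refine ⟨f, hf, hinj, dimH_image_lt, fun y _ => ?_⟩
  have fibre_subsingleton : (cantorSquare ∩ f ⁻¹' {y}).Subsingleton :=
    fun p hp q hq => hinj hp.1 hq.1 (hp.2.trans hq.2.symm)
  rwa [dimH_subsingleton fibre_subsingleton, add_zero]
/-! ### The fractal distribution of Lebesgue measure -/

theorem measurableSet_singleton_measure {α : Type*} [MeasurableSpace α]
    [MeasurableSpace.CountablyGenerated α] (L : Measure α) [SigmaFinite L] :
    MeasurableSet {L} := by
  set 𝒜 := generateSetAlgebra (MeasurableSpace.countableGeneratingSet α)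
  have h𝒜 : IsSetAlgebra 𝒜 := isSetAlgebra_generateSetAlgebra
  have hgen : ‹MeasurableSpace α› = MeasurableSpace.generateFrom 𝒜 :=
    (MeasurableSpace.generateFrom_countableGeneratingSet (α := α)).symm.trans
      generateFrom_generateSetAlgebra_eq.symm
  have hmeas : ∀ B ∈ 𝒜, MeasurableSet B := fun B hB => by
    rw [hgen]
    exact MeasurableSpace.measurableSet_generateFrom hB
  have heq : {L} = ⋂ n, ⋂ B ∈ 𝒜,
      {ν : Measure α | ν (B ∩ spanningSets L n) = L (B ∩ spanningSets L n)} := by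
    ext ν
    simp only [mem_singleton_iff, mem_iInter, mem_ofPred_eq]
    refine ⟨fun h n B _ => by rw [h], fun h => ?_⟩
    refine (Measure.ext_iff_of_iUnion_eq_univ (iUnion_spanningSets L)).2 fun n => Eq.symm ?_
    have : IsFiniteMeasure (L.restrict (spanningSets L n)) :=
      ⟨by simpa using measure_spanningSets_lt_top L n⟩
    have hrestrict : ∀ B ∈ 𝒜,
        L.restrict (spanningSets L n) B = ν.restrict (spanningSets L n) B := fun B hB => by
      rw [Measure.restrict_apply (hmeas B hB), Measure.restrict_apply (hmeas B hB), h n B hB]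
    exact ext_of_generate_finite 𝒜 hgen h𝒜.isSetRing.isSetSemiring.isPiSystem hrestrict
      (hrestrict univ h𝒜.univ_mem)
  rw [heq]
  refine MeasurableSet.iInter fun n => MeasurableSet.biInter
    (countable_generateSetAlgebra MeasurableSpace.countable_countableGeneratingSet) fun B hB =>
      measurableSet_eq_fun (Measure.measurable_coe ?_) measurable_const
  exact (hmeas B hB).inter (measurableSet_spanningSets L n)

theorem measurable_starNorm {d : ℕ} :
    Measurable (starNorm : Measure (Fin d → ℝ) → Measure (Fin d → ℝ)) := by
  refine Measure.measurable_of_measurable_coe _ fun s hs => ?_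
  simp only [starNorm, Measure.smul_apply, smul_eq_mul]
  exact (Measure.measurable_coe measurableSet_closedBall).inv.mul (Measure.measurable_coe hs)

theorem measurable_scaleMeas {d : ℕ} (t : ℝ) : Measurable (scaleMeas t (d := d)) :=
  Measure.measurable_map _ (by fun_prop)

section StarNorm

variable {d : ℕ} {μ : Measure (Fin d → ℝ)}

theorem starNorm_smul {c : ℝ≥0∞} (h0 : c ≠ 0) (htop : c ≠ ⊤) :
    starNorm (c • μ) = starNorm μ := by
  rw [starNorm, starNorm, Measure.smul_apply, smul_eq_mul, smul_smul,
    ENNReal.mul_inv (Or.inl h0) (Or.inl htop), mul_right_comm, ENNReal.inv_mul_cancel h0 htop,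
    one_mul]

variable [IsLocallyFiniteMeasure μ]

theorem starNorm_unitBall (h0 : μ (Metric.closedBall 0 1) ≠ 0) :
    starNorm μ (Metric.closedBall 0 1) = 1 := by
  rw [starNorm, Measure.smul_apply, smul_eq_mul,
    ENNReal.inv_mul_cancel h0 (isCompact_closedBall _ _).measure_ne_top]

theorem starNorm_map_starNorm (h0 : μ (Metric.closedBall 0 1) ≠ 0)
    (f : (Fin d → ℝ) → Fin d → ℝ) : starNorm ((starNorm μ).map f) = starNorm (μ.map f) := by
  rw [starNorm.eq_1 μ, Measure.map_smul, starNorm_smul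
    (ENNReal.inv_ne_zero.2 (isCompact_closedBall _ _).measure_ne_top) (ENNReal.inv_ne_top.2 h0)]

theorem isLocallyFiniteMeasure_starNorm (h0 : μ (Metric.closedBall 0 1) ≠ 0) :
    IsLocallyFiniteMeasure (starNorm μ) := by
  rw [starNorm]
  lift (μ (Metric.closedBall 0 1))⁻¹ to NNReal using ENNReal.inv_ne_top.2 h0 with c
  exact inferInstanceAs (IsLocallyFiniteMeasure (c • μ))

theorem isOpenPosMeasure_starNorm [μ.IsOpenPosMeasure] : (starNorm μ).IsOpenPosMeasure :=
  Measure.isOpenPosMeasure_smul _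
    (ENNReal.inv_ne_zero.2 (isCompact_closedBall _ _).measure_ne_top)

end StarNorm

/-- Lebesgue measure on `ℝ^d`, normalized to give mass one to the unit ball. -/
noncomputable def normLebesgue (d : ℕ) : Measure (Fin d → ℝ) := starNorm volume

theorem volume_unitBall_ne_zero (d : ℕ) : volume (Metric.closedBall (0 : Fin d → ℝ) 1) ≠ 0 :=
  (Metric.measure_closedBall_pos _ _ one_pos).ne'

instance isLocallyFiniteMeasure_normLebesgue (d : ℕ) :
    IsLocallyFiniteMeasure (normLebesgue d) :=
  isLocallyFiniteMeasure_starNorm (volume_unitBall_ne_zero d)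

instance isOpenPosMeasure_normLebesgue (d : ℕ) : (normLebesgue d).IsOpenPosMeasure :=
  isOpenPosMeasure_starNorm

theorem normLebesgue_unitBall (d : ℕ) : normLebesgue d (Metric.closedBall 0 1) = 1 :=
  starNorm_unitBall (volume_unitBall_ne_zero d)

theorem starNorm_scaleMeas_normLebesgue {d : ℕ} (t : ℝ) :
    starNorm (scaleMeas t (normLebesgue d)) = normLebesgue d := by
  have hdet : ENNReal.ofReal |(Real.exp t ^ Module.finrank ℝ (Fin d → ℝ))⁻¹| ≠ 0 := by
    rw [Ne, ENNReal.ofReal_eq_zero, not_le]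
    positivity
  rw [scaleMeas, normLebesgue, starNorm_map_starNorm (volume_unitBall_ne_zero d),
    Measure.map_addHaar_smul volume (Real.exp_ne_zero t), starNorm_smul hdet ENNReal.ofReal_ne_top]

theorem starNorm_translateMeas_normLebesgue {d : ℕ} (x : Fin d → ℝ) :
    starNorm (translateMeas x (normLebesgue d)) = normLebesgue d := by
  rw [translateMeas, normLebesgue, starNorm_map_starNorm (volume_unitBall_ne_zero d),
    (measurePreserving_sub_right volume x).map_eq]

theorem normLebesgue_real_closedBall {d : ℕ} (x : Fin d → ℝ) {r : ℝ} (hr : 0 ≤ r) :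
    (normLebesgue d).real (Metric.closedBall x r) = r ^ d := by
  rw [normLebesgue, starNorm, measureReal_ennreal_smul_apply, measureReal_def,
    Real.volume_pi_closedBall _ zero_le_one, Real.volume_pi_closedBall _ hr, Fintype.card_fin,
    ENNReal.toReal_inv, ENNReal.toReal_ofReal (by positivity),
    ENNReal.toReal_ofReal (by positivity), mul_one, mul_pow]
  field_simp

theorem hasExactDim_normLebesgue (d : ℕ) : HasExactDim (normLebesgue d) d := by
  refine Eventually.of_forall fun x => tendsto_const_nhds.congr' ?_
  filter_upwards [Ioo_mem_nhdsGT (zero_lt_one' ℝ)] with r hr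
  rw [localDimQuot, normLebesgue_real_closedBall x hr.1.le, Real.log_pow,
    mul_div_cancel_right₀ _ (Real.log_neg hr.1 hr.2).ne]

/-- The fractal distribution of Lebesgue measure: the point mass at `normLebesgue d`. -/
noncomputable def lebesgueEFD (d : ℕ) : Measure (Measure (Fin d → ℝ)) :=
  Measure.dirac (normLebesgue d)

instance isProbabilityMeasure_lebesgueEFD (d : ℕ) : IsProbabilityMeasure (lebesgueEFD d) :=
  inferInstanceAs (IsProbabilityMeasure (Measure.dirac (normLebesgue d)))

theorem ae_lebesgueEFD_iff {d : ℕ} {p : Measure (Fin d → ℝ) → Prop} :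
    (∀ᵐ ν ∂lebesgueEFD d, p ν) ↔ p (normLebesgue d) := by
  have hae : ∀ᵐ ν ∂lebesgueEFD d, ν = normLebesgue d :=
    (ae_dirac_iff (measurableSet_singleton_measure (normLebesgue d))).2 rfl
  refine ⟨fun h => ?_, fun h => hae.mono fun ν hν => hν ▸ h⟩
  obtain ⟨ν, hν, rfl⟩ := (h.and hae).exists
  exact hν

theorem integral_lebesgueEFD {d : ℕ} (F : Measure (Fin d → ℝ) → ℝ) :
    ∫ ν, F ν ∂lebesgueEFD d = F (normLebesgue d) := by
  rw [integral_congr_ae (g := fun _ => F (normLebesgue d)) (ae_lebesgueEFD_iff.2 rfl)]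
  simp

theorem isDistribution_lebesgueEFD (d : ℕ) : IsDistribution (lebesgueEFD d) := by
  refine ⟨inferInstance, ae_lebesgueEFD_iff.2 ⟨inferInstance, normLebesgue_unitBall d, ?_⟩⟩
  rw [Measure.support_eq_univ]
  exact mem_univ 0

theorem isScaleInvariant_lebesgueEFD (d : ℕ) : IsScaleInvariant (lebesgueEFD d) := fun t => by
  have hmeas : Measurable fun ν : Measure (Fin d → ℝ) => starNorm (scaleMeas t ν) :=
    measurable_starNorm.comp (measurable_scaleMeas t)
  exact ⟨hmeas, by rw [lebesgueEFD, Measure.map_dirac' hmeas, starNorm_scaleMeas_normLebesgue]⟩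

theorem isQuasiPalm_lebesgueEFD (d : ℕ) : IsQuasiPalm (lebesgueEFD d) := by
  intro U hU _ h0 A _
  have : (ae ((normLebesgue d).restrict U)).NeBot := by
    rw [ae_neBot, Ne, Measure.restrict_eq_zero]
    exact (hU.measure_pos _ ⟨0, h0⟩).ne'
  rw [measure_eq_zero_iff_ae_notMem, ae_lebesgueEFD_iff, ae_lebesgueEFD_iff]
  simp only [starNorm_translateMeas_normLebesgue, eventually_const]

theorem isEFD_lebesgueEFD (d : ℕ) : IsEFD (lebesgueEFD d) := by
  refine ⟨⟨isDistribution_lebesgueEFD d, isScaleInvariant_lebesgueEFD d,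
    isQuasiPalm_lebesgueEFD d⟩, fun A hA _ => ?_⟩
  rw [lebesgueEFD, Measure.dirac_apply' _ hA]
  exact indicator_eq_zero_or_self A 1 (normLebesgue d)
/-! ### Leading digits -/

section LeadingDigits

variable {b : ℕ} {a : ℕ → Fin b} {i k n : ℕ}

/-- The integer whose base `b` expansion consists of the first `n` digits of the sequence `a`, the
most significant one being `a 0`. -/
def leadingDigits (a : ℕ → Fin b) : ℕ → ℕ
  | 0 => 0
  | n + 1 => b * leadingDigits a n + a n

theorem leadingDigits_eq_iff {a' : ℕ → Fin b} :
    leadingDigits a n = leadingDigits a' n ↔ ∀ i < n, a i = a' i := by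
  induction n with
  | zero => simp [leadingDigits]
  | succ n ih =>
    simp only [Nat.lt_succ_iff_lt_or_eq, or_imp, forall_and, forall_eq, ← ih]
    refine ⟨fun h => ?_, fun ⟨hlow, hn⟩ => by rw [leadingDigits, leadingDigits, hlow, hn]⟩
    have hdiv := congrArg (· / b) h
    have hmod := congrArg (· % b) h
    simp only [leadingDigits, Nat.mul_add_div (Fin.pos (a 0)), Nat.mul_add_mod,
      Nat.div_eq_of_lt (Fin.is_lt _), Nat.mod_eq_of_lt (Fin.is_lt _), add_zero] at hdiv hmod
    exact ⟨hdiv, Fin.ext hmod⟩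

theorem leadingDigits_lt_pow (a : ℕ → Fin b) (n : ℕ) : leadingDigits a n < b ^ n := by
  induction n with
  | zero => simp [leadingDigits]
  | succ n ih =>
    rw [leadingDigits, pow_succ']
    have := Nat.mul_le_mul_left b (Nat.succ_le_of_lt ih)
    have := (a n).is_lt
    rw [Nat.mul_succ] at *
    omega

theorem exists_leadingDigits_eq [NeZero b] {u : ℕ} (hu : u < b ^ n) :
    ∃ a : ℕ → Fin b, leadingDigits a n = u := by
  induction n generalizing u with
  | zero => exact ⟨0, by simpa [leadingDigits, eq_comm] using hu⟩
  | succ n ih =>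
    obtain ⟨a, ha⟩ := ih (Nat.div_lt_of_lt_mul (pow_succ' b n ▸ hu))
    refine ⟨Function.update a n (Fin.ofNat b u), ?_⟩
    have hlow : leadingDigits (Function.update a n (Fin.ofNat b u)) n = leadingDigits a n :=
      leadingDigits_eq_iff.2 fun i hi => by simp [hi.ne]
    rw [leadingDigits, hlow, ha, Function.update_self, Fin.val_ofNat, Nat.div_add_mod]

theorem leadingDigits_add (a : ℕ → Fin b) (p k : ℕ) :
    leadingDigits a (p + k) = leadingDigits a p * b ^ k + leadingDigits (fun i => a (i + p)) k := by
  induction k with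
  | zero => simp [leadingDigits]
  | succ k ih => rw [← add_assoc, leadingDigits, ih, leadingDigits, pow_succ, add_comm k p]; ring

theorem ofDigits_mul_pow (a : ℕ → Fin b) (n : ℕ) :
    Real.ofDigits a * (b : ℝ) ^ n = leadingDigits a n + Real.ofDigits fun i => a (i + n) := by
  have hb : (b : ℝ) ≠ 0 := Nat.cast_ne_zero.2 (Fin.pos (a 0)).ne'
  induction n with
  | zero => simp [leadingDigits]
  | succ n ih =>
    have hshift := Real.ofDigits_eq_sum_add_ofDigits (fun i => a (i + n)) 1
    simp only [Finset.range_one, Finset.sum_singleton, Real.ofDigitsTerm, zero_add, pow_one,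
      add_assoc, add_comm 1 n] at hshift
    rw [pow_succ, ← mul_assoc, ih, hshift, leadingDigits]
    push_cast
    field_simp
    ring

theorem leadingDigits_le_ofDigits_mul (a : ℕ → Fin b) (n : ℕ) :
    (leadingDigits a n : ℝ) ≤ Real.ofDigits a * (b : ℝ) ^ n := by
  rw [ofDigits_mul_pow]
  exact le_add_of_nonneg_right (Real.ofDigits_nonneg _)

theorem ofDigits_mul_le_leadingDigits_add_one (a : ℕ → Fin b) (n : ℕ) :
    Real.ofDigits a * (b : ℝ) ^ n ≤ leadingDigits a n + 1 := by
  rw [ofDigits_mul_pow]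
  exact add_le_add_right (Real.ofDigits_le_one _) _

theorem inv_pow_le_ofDigits (hi : i < k) (ha : 0 < (a i : ℕ)) :
    ((b : ℝ) ^ k)⁻¹ ≤ Real.ofDigits a := by
  have hb : 1 ≤ (b : ℝ) := Nat.one_le_cast.2 (Fin.pos (a i))
  refine (inv_anti₀ (by positivity) (pow_le_pow_right₀ hb hi)).trans
    ((inv_le_iff_one_le_mul₀ (by positivity)).2 ?_)
  have hone : (1 : ℝ) ≤ leadingDigits a (i + 1) := by
    exact_mod_cast Nat.le_add_left_of_le (show 1 ≤ (a i : ℕ) from ha)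
  exact hone.trans (leadingDigits_le_ofDigits_mul a (i + 1))

theorem ofDigits_le_one_sub (hi : i < k) (ha : (a i : ℕ) + 1 < b) :
    Real.ofDigits a ≤ 1 - ((b : ℝ) ^ k)⁻¹ := by
  have hb : 1 ≤ (b : ℝ) := Nat.one_le_cast.2 (Fin.pos (a i))
  have hlead : leadingDigits a (i + 1) + 2 ≤ b ^ (i + 1) := by
    have := Nat.mul_le_mul_left b (Nat.succ_le_of_lt (leadingDigits_lt_pow a i))
    rw [leadingDigits, pow_succ']
    rw [Nat.mul_succ] at this
    omega
  have hle : Real.ofDigits a * (b : ℝ) ^ (i + 1) ≤ (b : ℝ) ^ (i + 1) - 1 := by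
    have : (leadingDigits a (i + 1) : ℝ) + 2 ≤ (b : ℝ) ^ (i + 1) := by exact_mod_cast hlead
    linarith [ofDigits_mul_le_leadingDigits_add_one a (i + 1)]
  have hinv : ((b : ℝ) ^ k)⁻¹ ≤ ((b : ℝ) ^ (i + 1))⁻¹ :=
    inv_anti₀ (by positivity) (pow_le_pow_right₀ hb hi)
  calc Real.ofDigits a ≤ ((b : ℝ) ^ (i + 1) - 1) / (b : ℝ) ^ (i + 1) :=
        (le_div_iff₀ (by positivity)).2 hle
    _ = 1 - ((b : ℝ) ^ (i + 1))⁻¹ := by field_simp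
    _ ≤ 1 - ((b : ℝ) ^ k)⁻¹ := sub_le_sub_left hinv 1

theorem leadingDigits_eq_floor (ha : ∃ᶠ i in atTop, (a i : ℕ) + 1 < b) :
    leadingDigits a n = ⌊Real.ofDigits a * (b : ℝ) ^ n⌋₊ := by
  obtain ⟨i, hni, hi⟩ := frequently_atTop.1 ha n
  have htail := ofDigits_le_one_sub (a := fun j => a (j + n)) (Nat.lt_add_one (i - n))
    (by simpa only [Nat.sub_add_cancel hni] using hi)
  have hpos : 0 < ((b : ℝ) ^ (i - n + 1))⁻¹ :=
    inv_pos.2 (pow_pos (Nat.cast_pos.2 (Fin.pos (a i))) _)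
  rw [ofDigits_mul_pow, add_comm, Nat.floor_add_natCast (Real.ofDigits_nonneg _),
    Nat.floor_eq_zero.2 (by linarith), zero_add]

theorem injOn_ofDigits :
    InjOn (Real.ofDigits (b := b)) {a | ∃ᶠ i in atTop, (a i : ℕ) + 1 < b} := by
  refine fun a ha a' ha' h => funext fun n => leadingDigits_eq_iff.1 ?_ n n.lt_succ_self
  rw [leadingDigits_eq_floor ha, leadingDigits_eq_floor ha', h]

end LeadingDigits

theorem measurable_leadingDigits {b : ℕ} (n : ℕ) :
    Measurable fun a : ℕ → Fin b => leadingDigits a n := by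
  induction n with
  | zero => exact measurable_const
  | succ n ih =>
    exact (ih.const_mul b).add ((measurable_of_finite _).comp (measurable_pi_apply n))

section Intervals

variable {b n : ℕ} {a : ℕ → Fin b} {y z : ℝ}

theorem leadingDigits_mem_Icc_of_ofDigits_mem_Icc (h : Real.ofDigits a ∈ Icc y z) :
    leadingDigits a n ∈ Finset.Icc ⌈y * (b : ℝ) ^ n - 1⌉₊ ⌊z * (b : ℝ) ^ n⌋₊ := by
  have hpow : (0 : ℝ) ≤ (b : ℝ) ^ n := by positivity
  refine Finset.mem_Icc.2 ⟨Nat.ceil_le.2 ?_, Nat.le_floor ?_⟩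
  · linarith [ofDigits_mul_le_leadingDigits_add_one a n, mul_le_mul_of_nonneg_right h.1 hpow]
  · linarith [leadingDigits_le_ofDigits_mul a n, mul_le_mul_of_nonneg_right h.2 hpow]

theorem ofDigits_mem_Icc_of_leadingDigits_mem_Ico
    (h : leadingDigits a n ∈ Finset.Ico ⌈y * (b : ℝ) ^ n⌉₊ ⌊z * (b : ℝ) ^ n⌋₊) :
    Real.ofDigits a ∈ Icc y z := by
  have hpow : (0 : ℝ) < (b : ℝ) ^ n := pow_pos (Nat.cast_pos.2 (Fin.pos (a 0))) n
  obtain ⟨hlow, hup⟩ := Finset.mem_Ico.1 h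
  have hup' : ((leadingDigits a n + 1 : ℕ) : ℝ) ≤ z * (b : ℝ) ^ n :=
    (Nat.le_floor_iff' (Nat.succ_ne_zero _)).1 hup
  push_cast at hup'
  exact ⟨le_of_mul_le_mul_right ((Nat.ceil_le.1 hlow).trans (leadingDigits_le_ofDigits_mul a n))
    hpow, le_of_mul_le_mul_right ((ofDigits_mul_le_leadingDigits_add_one a n).trans hup') hpow⟩

theorem exists_eq_mul_pow_add_of_mem_Ico {p k X i : ℕ} (hy : X ≤ y * (b : ℝ) ^ p)
    (hz : z * (b : ℝ) ^ p ≤ X + 1)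
    (hi : i ∈ Finset.Ico ⌈y * (b : ℝ) ^ (p + k)⌉₊ ⌊z * (b : ℝ) ^ (p + k)⌋₊) :
    ∃ u < b ^ k, i = X * b ^ k + u := by
  have hpow : (0 : ℝ) ≤ (b : ℝ) ^ k := by positivity
  rw [pow_add, ← mul_assoc, ← mul_assoc, Finset.mem_Ico] at hi
  have hlow : X * b ^ k ≤ i := by
    exact_mod_cast (mul_le_mul_of_nonneg_right hy hpow).trans (Nat.ceil_le.1 hi.1)
  have hup : i + 1 ≤ (X + 1) * b ^ k := by
    exact_mod_cast ((Nat.le_floor_iff' (Nat.succ_ne_zero i)).1 hi.2).trans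
      (mul_le_mul_of_nonneg_right hz hpow)
  rw [add_mul, one_mul] at hup
  exact ⟨i - X * b ^ k, by omega, by omega⟩

end Intervals

theorem card_Icc_ceil_floor_le {y z : ℝ} (h : y ≤ z) :
    ((Finset.Icc ⌈y - 1⌉₊ ⌊z⌋₊).card : ℝ) ≤ z - y + 2 := by
  rw [Nat.card_Icc]
  rcases le_total (⌊z⌋₊ + 1) ⌈y - 1⌉₊ with hempty | hle
  · rw [Nat.sub_eq_zero_of_le hempty]
    push_cast
    linarith
  · rw [Nat.cast_sub hle]
    push_cast
    have hceil := Nat.le_ceil (y - 1)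
    rcases le_total 0 z with hz | hz
    · linarith [Nat.floor_le hz]
    · rw [Nat.floor_of_nonpos hz]
      push_cast
      linarith [Nat.cast_nonneg (α := ℝ) ⌈y - 1⌉₊]

theorem sub_le_card_Ico_ceil_floor {y : ℝ} (z : ℝ) (h : 0 ≤ y) :
    z - y - 2 ≤ ((Finset.Ico ⌈y⌉₊ ⌊z⌋₊).card : ℝ) := by
  rw [Nat.card_Ico]
  have hsub : (⌊z⌋₊ : ℝ) ≤ ((⌊z⌋₊ - ⌈y⌉₊ : ℕ) : ℝ) + ⌈y⌉₊ := by exact_mod_cast le_tsub_add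
  linarith [Nat.ceil_lt_add_one h, Nat.lt_floor_add_one z]
/-! ### A planar measure whose first coordinate encodes the second one at sparse scales -/

/-- The sequences of pairs of bits. -/
abbrev BitPairSeq : Type := ℕ → Fin 2 × Fin 2

/-- A position is coding if it is a power of two. -/
def IsCoding (i : ℕ) : Prop := 2 ^ Nat.log 2 i = i

instance : DecidablePred IsCoding := fun _ => inferInstanceAs (Decidable (_ = _))

/-- The binary digits of the two coordinates of the point coded by `w`. The digits of the second
coordinate are free. The digits of the first one at the coding positions `2 ^ (2 * j)` repeat the
`j`-th digit of the second one, those at the coding positions `2 ^ (2 * j + 1)` vanish, so that the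
expansion has infinitely many zeros, and the other ones are free. -/
def codedDigits (w : BitPairSeq) : Fin 2 → ℕ → Fin 2 :=
  ![fun i => if IsCoding i then if Even (Nat.log 2 i) then (w (Nat.log 2 i / 2)).2 else 0
    else (w i).1, fun i => (w i).2]

/-- The point of the plane coded by a sequence of pairs of bits. -/
noncomputable def codedPoint (w : BitPairSeq) : Fin 2 → ℝ :=
  fun c => Real.ofDigits (codedDigits w c)

theorem isCoding_two_pow (j : ℕ) : IsCoding (2 ^ j) := by
  rw [IsCoding, Nat.log_pow Nat.one_lt_two]

theorem IsCoding.log_div_two_lt {i : ℕ} (hi : IsCoding i) : Nat.log 2 i / 2 < i := by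
  have h0 : i ≠ 0 := by
    rintro rfl
    simp [IsCoding] at hi
  exact (Nat.div_le_self _ _).trans_lt (Nat.log_lt_self 2 h0)

section CodedDigits

variable (w : BitPairSeq)

theorem codedDigits_zero_of_isCoding {i : ℕ} (hi : IsCoding i) :
    codedDigits w 0 i = if Even (Nat.log 2 i) then (w (Nat.log 2 i / 2)).2 else 0 :=
  if_pos hi

theorem codedDigits_zero_of_not_isCoding {i : ℕ} (hi : ¬IsCoding i) :
    codedDigits w 0 i = (w i).1 :=
  if_neg hi

theorem codedDigits_of_not_isCoding {i : ℕ} (hi : ¬IsCoding i) (c : Fin 2) :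
    codedDigits w c i = ![(w i).1, (w i).2] c := by
  fin_cases c
  · exact codedDigits_zero_of_not_isCoding w hi
  · rfl

theorem codedDigits_zero_two_pow_even (j : ℕ) :
    codedDigits w 0 (2 ^ (2 * j)) = codedDigits w 1 j := by
  rw [codedDigits_zero_of_isCoding w (isCoding_two_pow _), Nat.log_pow Nat.one_lt_two,
    if_pos (even_two_mul j), Nat.mul_div_cancel_left _ two_pos]
  rfl

theorem codedDigits_zero_two_pow_odd (j : ℕ) : codedDigits w 0 (2 ^ (2 * j + 1)) = 0 := by
  rw [codedDigits_zero_of_isCoding w (isCoding_two_pow _), Nat.log_pow Nat.one_lt_two,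
    if_neg (Nat.not_even_two_mul_add_one j)]

theorem frequently_codedDigits_zero_lt :
    ∃ᶠ i in atTop, (codedDigits w 0 i : ℕ) + 1 < 2 := by
  refine frequently_atTop.2 fun n => ⟨2 ^ (2 * n + 1), ?_, ?_⟩
  · have := Nat.lt_two_pow_self (n := 2 * n + 1)
    omega
  · simp [codedDigits_zero_two_pow_odd]

end CodedDigits

theorem injOn_proj₁_range_codedPoint : InjOn proj₁ (range codedPoint) := by
  rintro _ ⟨w, rfl⟩ _ ⟨w', rfl⟩ h
  have h0 : codedDigits w 0 = codedDigits w' 0 :=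
    injOn_ofDigits (frequently_codedDigits_zero_lt w) (frequently_codedDigits_zero_lt w') h
  have h1 : codedDigits w 1 = codedDigits w' 1 := funext fun j => by
    rw [← codedDigits_zero_two_pow_even, ← codedDigits_zero_two_pow_even, h0]
  have hdigits : codedDigits w = codedDigits w' := funext (Fin.forall_fin_two.2 ⟨h0, h1⟩)
  exact congrArg (fun a c => Real.ofDigits (a c)) hdigits

theorem continuous_codedDigits : Continuous codedDigits := by
  refine continuous_pi (Fin.forall_fin_two.2
    ⟨continuous_pi fun i => ?_, continuous_pi fun i => ?_⟩)
  · by_cases hi : IsCoding i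
    · simp only [codedDigits_zero_of_isCoding _ hi]
      split_ifs <;> fun_prop
    · simp only [codedDigits_zero_of_not_isCoding _ hi]
      fun_prop
  · change Continuous fun w : BitPairSeq => (w i).2
    fun_prop

theorem continuous_codedPoint : Continuous codedPoint :=
  continuous_pi fun c =>
    Real.continuous_ofDigits.comp ((continuous_apply c).comp continuous_codedDigits)

theorem measurable_codedPoint : Measurable codedPoint := continuous_codedPoint.measurable

instance isProbabilityMeasure_uniformOn_bitPair :
    IsProbabilityMeasure (ProbabilityTheory.uniformOn (univ : Set (Fin 2 × Fin 2))) :=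
  ProbabilityTheory.isProbabilityMeasure_uniformOn finite_univ univ_nonempty

/-- The law of a sequence of independent pairs of independent fair coin tosses. -/
noncomputable def fairCoins : Measure BitPairSeq :=
  Measure.infinitePi fun _ => ProbabilityTheory.uniformOn univ

instance isProbabilityMeasure_fairCoins : IsProbabilityMeasure fairCoins :=
  inferInstanceAs (IsProbabilityMeasure (Measure.infinitePi _))

theorem fairCoins_real_pi (s : Finset ℕ) (t : ℕ → Finset (Fin 2 × Fin 2)) :
    fairCoins.real (Set.pi s fun i => (t i : Set (Fin 2 × Fin 2))) =
      ∏ i ∈ s, ((t i).card : ℝ) / 4 := by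
  rw [measureReal_def, fairCoins, Measure.infinitePi_pi _ fun i _ => (t i).measurableSet,
    ENNReal.toReal_prod]
  refine Finset.prod_congr rfl fun i _ => ?_
  rw [ProbabilityTheory.uniformOn_univ, Measure.count_apply_finset, ENNReal.toReal_div]
  simp

/-- The law of the point coded by independent fair bits. It has dimension two, but it is carried by
a compact set on which the first coordinate determines the point. -/
noncomputable def codedMeasure : Measure (Fin 2 → ℝ) := fairCoins.map codedPoint

instance isProbabilityMeasure_codedMeasure : IsProbabilityMeasure codedMeasure :=
  Measure.isProbabilityMeasure_map measurable_codedPoint.aemeasurable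

theorem codedMeasure_real_apply {s : Set (Fin 2 → ℝ)} (hs : MeasurableSet s) :
    codedMeasure.real s = fairCoins.real (codedPoint ⁻¹' s) :=
  map_measureReal_apply measurable_codedPoint hs

/-! ### Dyadic cells -/

/-- The event that the `c`-th coordinate of the coded point has an expansion with leading digits
`q c` up to level `n`, for each `c`. -/
def cell (n : ℕ) (q : Fin 2 → ℕ) : Set BitPairSeq :=
  {w | ∀ c, leadingDigits (codedDigits w c) n = q c}

theorem measurableSet_cell (n : ℕ) (q : Fin 2 → ℕ) : MeasurableSet (cell n q) := by
  simp only [cell, ofPred_forall]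
  exact MeasurableSet.iInter fun c => ((measurable_leadingDigits n).comp
    ((measurable_pi_apply c).comp continuous_codedDigits.measurable)) (measurableSet_singleton _)

theorem fairCoins_real_biUnion_cell (n : ℕ) (s : Finset (Fin 2 → ℕ)) :
    fairCoins.real (⋃ q ∈ s, cell n q) = ∑ q ∈ s, fairCoins.real (cell n q) := by
  refine measureReal_biUnion_finset (fun q _ q' _ hne => ?_) fun q _ => measurableSet_cell n q
  exact disjoint_left.2 fun w hq hq' => hne (funext fun c => (hq c).symm.trans (hq' c))

theorem forall_codedDigits_eq_iff {w w' : BitPairSeq} {n : ℕ} :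
    (∀ c, ∀ i < n, codedDigits w' c i = codedDigits w c i) ↔
      ∀ i < n, (IsCoding i ∨ (w' i).1 = (w i).1) ∧ (w' i).2 = (w i).2 := by
  rw [Fin.forall_fin_two]
  constructor
  · rintro ⟨h0, h1⟩ i hi
    refine ⟨or_iff_not_imp_left.2 fun hc => ?_, h1 i hi⟩
    rw [← codedDigits_zero_of_not_isCoding w' hc, h0 i hi, codedDigits_zero_of_not_isCoding w hc]
  · refine fun h => ⟨fun i hi => ?_, fun i hi => (h i hi).2⟩
    by_cases hc : IsCoding i
    · rw [codedDigits_zero_of_isCoding w' hc, codedDigits_zero_of_isCoding w hc,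
        (h _ (hc.log_div_two_lt.trans hi)).2]
    · rw [codedDigits_zero_of_not_isCoding w' hc, codedDigits_zero_of_not_isCoding w hc]
      exact (h i hi).1.resolve_left hc

/-- The mass of a nonempty dyadic cell of level `n`: of the two bits at a position, the first one is
not used if the position is coding. -/
noncomputable def cellMass (n : ℕ) : ℝ :=
  ∏ i ∈ Finset.range n, if IsCoding i then 1 / 2 else 1 / 4

theorem cellMass_succ (n : ℕ) :
    cellMass (n + 1) = cellMass n * if IsCoding n then 1 / 2 else 1 / 4 :=
  Finset.prod_range_succ _ n

theorem cellMass_pos (n : ℕ) : 0 < cellMass n :=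
  Finset.prod_pos fun i _ => by split_ifs <;> norm_num

theorem fairCoins_real_cell (n : ℕ) (w : BitPairSeq) :
    fairCoins.real (cell n fun c => leadingDigits (codedDigits w c) n) = cellMass n := by
  have hpi : (cell n fun c => leadingDigits (codedDigits w c) n) = Set.pi (Finset.range n) fun i =>
      ((if IsCoding i then Finset.univ else {(w i).1}) ×ˢ {(w i).2} : Finset (Fin 2 × Fin 2)) := by
    ext w'
    simp only [cell, mem_ofPred_eq, leadingDigits_eq_iff, forall_codedDigits_eq_iff, Set.mem_pi,
      Finset.coe_range, mem_Iio, Finset.mem_coe, Finset.mem_product, Finset.mem_singleton]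
    refine forall₂_congr fun i _ => and_congr_left fun _ => ?_
    split_ifs with hc <;> simp [hc]
  rw [hpi, fairCoins_real_pi, cellMass]
  refine Finset.prod_congr rfl fun i _ => ?_
  rw [Finset.card_product, Finset.card_singleton]
  split_ifs <;> norm_num

theorem fairCoins_real_cell_le (n : ℕ) (q : Fin 2 → ℕ) :
    fairCoins.real (cell n q) ≤ cellMass n := by
  rcases (cell n q).eq_empty_or_nonempty with h | ⟨w, hw⟩
  · rw [h, measureReal_empty]
    exact (cellMass_pos n).le
  · rw [← funext hw, fairCoins_real_cell]

theorem exists_leadingDigits_codedDigits_eq {p k : ℕ} (hfree : ∀ l ∈ Ico p (p + k), ¬IsCoding l)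
    (w : BitPairSeq) {u : Fin 2 → ℕ} (hu : ∀ c, u c < 2 ^ k) :
    ∃ w', ∀ c, leadingDigits (codedDigits w' c) (p + k) =
      leadingDigits (codedDigits w c) p * 2 ^ k + u c := by
  choose a ha using fun c => exists_leadingDigits_eq (hu c)
  refine ⟨fun i => if i < p then w i else (a 0 (i - p), a 1 (i - p)), fun c => ?_⟩
  rw [leadingDigits_add, ← ha c]
  congr 1
  · congr 1
    refine leadingDigits_eq_iff.2 (forall_codedDigits_eq_iff.2 (fun i hi => ?_) c)
    simp [hi]
  · refine leadingDigits_eq_iff.2 fun i hi => ?_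
    revert c
    refine Fin.forall_fin_two.2 ⟨?_, ?_⟩
    · rw [codedDigits_zero_of_not_isCoding _ (hfree _ ⟨Nat.le_add_left _ _, by omega⟩)]
      simp
    · simp [codedDigits]

/-- Below a cell of level `p`, all subcells are nonempty up to the next coding position. -/
theorem fairCoins_real_cell_of_free {p k : ℕ} (hfree : ∀ l ∈ Ico p (p + k), ¬IsCoding l)
    (w : BitPairSeq) {u : Fin 2 → ℕ} (hu : ∀ c, u c < 2 ^ k) :
    fairCoins.real (cell (p + k) fun c => leadingDigits (codedDigits w c) p * 2 ^ k + u c) =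
      cellMass (p + k) := by
  obtain ⟨w', hw'⟩ := exists_leadingDigits_codedDigits_eq hfree w hu
  rw [← funext hw', fairCoins_real_cell]

theorem one_le_cellMass_mul_pow (n : ℕ) : 1 ≤ cellMass n * 4 ^ n := by
  induction n with
  | zero => simp [cellMass]
  | succ n ih =>
    rw [cellMass_succ, pow_succ]
    split_ifs <;> linarith

theorem cellMass_succ_mul_pow_le (n : ℕ) : cellMass (n + 1) * 4 ^ (n + 1) ≤ 2 ^ Nat.size n := by
  induction n with
  | zero => simp [cellMass, IsCoding]
  | succ n ih =>
    rw [cellMass_succ, pow_succ]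
    have hmono : (2 : ℝ) ^ Nat.size n ≤ 2 ^ Nat.size (n + 1) :=
      pow_le_pow_right₀ one_le_two (Nat.size_le_size n.le_succ)
    split_ifs with hc
    · have hsize : Nat.size n + 1 ≤ Nat.size (n + 1) := by
        have hlog : 2 ^ Nat.log 2 (n + 1) = n + 1 := hc
        rw [← hlog, Nat.size_pow, Nat.succ_le_succ_iff, Nat.size_le]
        omega
      have hpow : (2 : ℝ) ^ (Nat.size n + 1) ≤ 2 ^ Nat.size (n + 1) :=
        pow_le_pow_right₀ one_le_two hsize
      rw [pow_succ] at hpow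
      linarith
    · linarith

theorem cellMass_mul_pow_le (n : ℕ) : cellMass n * 4 ^ n ≤ 2 * (n + 1) := by
  rcases n with _ | n
  · simp [cellMass]
  · have hsize : 2 ^ Nat.size n ≤ 2 * (n + 2) := by
      rcases Nat.eq_zero_or_pos (Nat.size n) with h | h
      · rw [h]
        omega
      · have hpred : 2 ^ (Nat.size n - 1) ≤ n := Nat.lt_size.1 (by omega)
        have hpow : 2 ^ Nat.size n = 2 ^ (Nat.size n - 1) * 2 := by
          rw [← pow_succ, Nat.sub_add_cancel h]
        omega
    calc cellMass (n + 1) * 4 ^ (n + 1) ≤ 2 ^ Nat.size n := cellMass_succ_mul_pow_le n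
      _ ≤ 2 * ((n : ℝ) + 2) := by exact_mod_cast hsize
      _ = 2 * ((n + 1 : ℕ) + 1) := by push_cast; ring
/-! ### The measure of boxes -/

theorem codedPoint_mem_Icc_iff {w : BitPairSeq} {a b : Fin 2 → ℝ} :
    codedPoint w ∈ Icc a b ↔ ∀ c, Real.ofDigits (codedDigits w c) ∈ Icc (a c) (b c) := by
  simp only [mem_Icc, Pi.le_def, forall_and, codedPoint]

theorem codedMeasure_real_Icc_le (n : ℕ) {a b : Fin 2 → ℝ} (hab : a ≤ b) :
    codedMeasure.real (Icc a b) ≤ cellMass n * ∏ c, ((b c - a c) * 2 ^ n + 2) := by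
  set I : Fin 2 → Finset ℕ := fun c => Finset.Icc ⌈a c * 2 ^ n - 1⌉₊ ⌊b c * 2 ^ n⌋₊
  have hsub : codedPoint ⁻¹' Icc a b ⊆ ⋃ q ∈ Fintype.piFinset I, cell n q := by
    refine fun w hw => mem_iUnion₂.2 ⟨fun c => leadingDigits (codedDigits w c) n, ?_, fun c => rfl⟩
    refine Fintype.mem_piFinset.2 fun c => ?_
    simpa only [Nat.cast_ofNat] using
      leadingDigits_mem_Icc_of_ofDigits_mem_Icc (codedPoint_mem_Icc_iff.1 hw c)
  have hcard : ∀ c, ((I c).card : ℝ) ≤ (b c - a c) * 2 ^ n + 2 := fun c => by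
    rw [sub_mul]
    exact card_Icc_ceil_floor_le (mul_le_mul_of_nonneg_right (hab c) (by positivity))
  calc codedMeasure.real (Icc a b) = fairCoins.real (codedPoint ⁻¹' Icc a b) :=
        codedMeasure_real_apply measurableSet_Icc
    _ ≤ fairCoins.real (⋃ q ∈ Fintype.piFinset I, cell n q) :=
        measureReal_mono hsub (measure_ne_top _ _)
    _ ≤ ∑ _q ∈ Fintype.piFinset I, cellMass n := by
        rw [fairCoins_real_biUnion_cell]
        exact Finset.sum_le_sum fun q _ => fairCoins_real_cell_le n q
    _ = cellMass n * ∏ c, ((I c).card : ℝ) := by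
        rw [Finset.sum_const, Fintype.card_piFinset, nsmul_eq_mul, mul_comm, Nat.cast_prod]
    _ ≤ cellMass n * ∏ c, ((b c - a c) * 2 ^ n + 2) :=
        mul_le_mul_of_nonneg_left
          (Finset.prod_le_prod (fun c _ => Nat.cast_nonneg _) fun c _ => hcard c)
          (cellMass_pos n).le

theorem le_codedMeasure_real_Icc {p k : ℕ} (hfree : ∀ l ∈ Ico p (p + k), ¬IsCoding l)
    (w : BitPairSeq) {a b : Fin 2 → ℝ} (ha : ∀ c, leadingDigits (codedDigits w c) p ≤ a c * 2 ^ p)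
    (hb : ∀ c, b c * 2 ^ p ≤ leadingDigits (codedDigits w c) p + 1) :
    cellMass (p + k) * ∏ c, max 0 ((b c - a c) * 2 ^ (p + k) - 2) ≤
      codedMeasure.real (Icc a b) := by
  set I : Fin 2 → Finset ℕ := fun c =>
    Finset.Ico ⌈a c * 2 ^ (p + k)⌉₊ ⌊b c * 2 ^ (p + k)⌋₊
  have hsub : (⋃ q ∈ Fintype.piFinset I, cell (p + k) q) ⊆ codedPoint ⁻¹' Icc a b := by
    refine iUnion₂_subset fun q hq w' hw' => codedPoint_mem_Icc_iff.2 fun c => ?_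
    refine ofDigits_mem_Icc_of_leadingDigits_mem_Ico (n := p + k) ?_
    simpa only [hw' c, Nat.cast_ofNat] using Fintype.mem_piFinset.1 hq c
  have hcell : ∀ q ∈ Fintype.piFinset I, fairCoins.real (cell (p + k) q) = cellMass (p + k) := by
    intro q hq
    have hsub_index : ∀ c, ∃ u < 2 ^ k, q c = leadingDigits (codedDigits w c) p * 2 ^ k + u :=
      fun c => exists_eq_mul_pow_add_of_mem_Ico (y := a c) (z := b c)
        (by simpa only [Nat.cast_ofNat] using ha c) (by simpa only [Nat.cast_ofNat] using hb c)
        (by simpa only [Nat.cast_ofNat] using Fintype.mem_piFinset.1 hq c)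
    choose u hu hqu using hsub_index
    rw [funext hqu, fairCoins_real_cell_of_free hfree w hu]
  have hcard : ∀ c, max 0 ((b c - a c) * 2 ^ (p + k) - 2) ≤ ((I c).card : ℝ) := fun c => by
    have hpos : 0 ≤ a c :=
      nonneg_of_mul_nonneg_left ((Nat.cast_nonneg _).trans (ha c)) (by positivity)
    rw [sub_mul]
    exact max_le (Nat.cast_nonneg _) (sub_le_card_Ico_ceil_floor _ (by positivity))
  calc cellMass (p + k) * ∏ c, max 0 ((b c - a c) * 2 ^ (p + k) - 2)
      ≤ cellMass (p + k) * ∏ c, ((I c).card : ℝ) :=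
        mul_le_mul_of_nonneg_left
          (Finset.prod_le_prod (fun c _ => le_max_left _ _) fun c _ => hcard c) (cellMass_pos _).le
    _ = ∑ q ∈ Fintype.piFinset I, fairCoins.real (cell (p + k) q) := by
        rw [Finset.sum_congr rfl hcell, Finset.sum_const, Fintype.card_piFinset, nsmul_eq_mul,
          mul_comm, Nat.cast_prod]
    _ ≤ fairCoins.real (codedPoint ⁻¹' Icc a b) := by
        rw [← fairCoins_real_biUnion_cell]
        exact measureReal_mono hsub
    _ = codedMeasure.real (Icc a b) := (codedMeasure_real_apply measurableSet_Icc).symm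

theorem codedPoint_mem_Icc_zero_one (w : BitPairSeq) : codedPoint w ∈ Icc 0 1 :=
  codedPoint_mem_Icc_iff.2 fun _ => ⟨Real.ofDigits_nonneg _, Real.ofDigits_le_one _⟩

theorem codedMeasure_real_eq_le (i : Fin 2) (y : ℝ) (n : ℕ) :
    codedMeasure.real {z | z i = y} ≤ 12 * ((n + 1) * (1 / 2) ^ n) := by
  set a : Fin 2 → ℝ := Function.update 0 i y with ha
  set b : Fin 2 → ℝ := Function.update 1 i y with hb
  have hab : a ≤ b := update_le_update_iff.2 ⟨le_rfl, fun _ _ => zero_le_one⟩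
  have hsub : codedPoint ⁻¹' {z | z i = y} ⊆ codedPoint ⁻¹' Icc a b := by
    rintro w rfl
    obtain ⟨hw0, hw1⟩ := codedPoint_mem_Icc_zero_one w
    exact ⟨update_le_iff.2 ⟨le_rfl, fun j _ => hw0 j⟩, le_update_iff.2 ⟨le_rfl, fun j _ => hw1 j⟩⟩
  have hslab : codedMeasure.real {z | z i = y} ≤ codedMeasure.real (Icc a b) := by
    rw [codedMeasure_real_apply (measurableSet_eq_fun (measurable_pi_apply i) measurable_const),
      codedMeasure_real_apply measurableSet_Icc]
    exact measureReal_mono hsub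
  have hprod : ∏ c, ((b c - a c) * 2 ^ n + 2) = 2 * (2 ^ n + 2) := by
    fin_cases i <;> simp [ha, hb, Fin.prod_univ_two, mul_comm]
  have hone : (1 : ℝ) ≤ 2 ^ n := one_le_pow₀ one_le_two
  calc codedMeasure.real {z | z i = y} ≤ cellMass n * (2 * (2 ^ n + 2)) :=
        hslab.trans ((codedMeasure_real_Icc_le n hab).trans_eq (by rw [hprod]))
    _ ≤ cellMass n * (6 * 2 ^ n) := mul_le_mul_of_nonneg_left (by linarith) (cellMass_pos n).le
    _ = 6 * (cellMass n * 4 ^ n) * (1 / 2) ^ n := by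
        rw [show (4 : ℝ) ^ n = 2 ^ n * 2 ^ n by rw [← mul_pow]; norm_num, one_div, inv_pow]
        field_simp
    _ ≤ 6 * (2 * (n + 1)) * (1 / 2) ^ n := by
        have := cellMass_mul_pow_le n
        gcongr
    _ = 12 * ((n + 1) * (1 / 2) ^ n) := by ring

theorem codedMeasure_eq_zero (i : Fin 2) (y : ℝ) : codedMeasure {z | z i = y} = 0 := by
  have hlim : Tendsto (fun n : ℕ => 12 * (((n : ℝ) + 1) * (1 / 2) ^ n)) atTop (𝓝 0) := by
    have hsum := (tendsto_self_mul_const_pow_of_lt_one (r := 1 / 2) (by norm_num)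
      (by norm_num)).add (tendsto_pow_atTop_nhds_zero_of_lt_one (r := (1 / 2 : ℝ)) (by norm_num)
      (by norm_num))
    simpa only [add_mul, one_mul, add_zero, mul_zero] using hsum.const_mul 12
  exact (measureReal_eq_zero_iff (by finiteness)).1
    ((ge_of_tendsto' hlim (codedMeasure_real_eq_le i y)).antisymm measureReal_nonneg)

theorem closedBall_eq_Icc_pi {ι : Type*} [Fintype ι] (z : ι → ℝ) {r : ℝ} (hr : 0 ≤ r) :
    Metric.closedBall z r = Icc (fun i => z i - r) fun i => z i + r := by
  simp only [closedBall_pi _ hr, ← pi_univ_Icc, Real.closedBall_eq_Icc]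
/-! ### Local dimension -/

section LocalDimension

variable {c s r v : ℝ}

theorem log_div_log_le (hc : 0 < c) (hr : r ∈ Ioo 0 1) (h : c * r ^ s ≤ v) :
    Real.log v / Real.log r ≤ Real.log c / Real.log r + s := by
  have hL := Real.log_neg hr.1 hr.2
  have hrs := Real.rpow_pos_of_pos hr.1 s
  have hlog := Real.log_le_log (mul_pos hc hrs) h
  rw [Real.log_mul hc.ne' hrs.ne', Real.log_rpow hr.1] at hlog
  rwa [div_le_iff_of_neg hL, add_mul, div_mul_cancel₀ _ hL.ne]

theorem le_log_div_log (hc : 0 < c) (hr : r ∈ Ioo 0 1) (hv : 0 < v) (h : v ≤ c * r ^ s) :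
    Real.log c / Real.log r + s ≤ Real.log v / Real.log r := by
  have hL := Real.log_neg hr.1 hr.2
  have hlog := Real.log_le_log hv h
  rw [Real.log_mul hc.ne' (Real.rpow_pos_of_pos hr.1 s).ne', Real.log_rpow hr.1] at hlog
  rwa [le_div_iff_of_neg hL, add_mul, div_mul_cancel₀ _ hL.ne]

theorem tendsto_const_div_log_nhdsGT_zero (c : ℝ) :
    Tendsto (fun r => c / Real.log r) (𝓝[>] 0) (𝓝 0) :=
  tendsto_const_nhds.div_atBot Real.tendsto_log_nhdsGT_zero

theorem tendsto_log_div_log {v C : ℝ → ℝ} (hc : 0 < c)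
    (hC : Tendsto (fun r => Real.log (C r) / Real.log r) (𝓝[>] 0) (𝓝 0))
    (hC0 : ∀ r ∈ Ioo (0 : ℝ) 1, 0 < C r) (hlow : ∀ r ∈ Ioo (0 : ℝ) 1, c * r ^ s ≤ v r)
    (hup : ∀ r ∈ Ioo (0 : ℝ) 1, v r ≤ C r * r ^ s) :
    Tendsto (fun r => Real.log (v r) / Real.log r) (𝓝[>] 0) (𝓝 s) := by
  have hC' := hC.add_const s
  have hc' := (tendsto_const_div_log_nhdsGT_zero (Real.log c)).add_const s
  rw [zero_add] at hC' hc'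
  have hsmall := Ioo_mem_nhdsGT (zero_lt_one' ℝ)
  refine tendsto_of_tendsto_of_tendsto_of_le_of_le' hC' hc' ?_ ?_
  · filter_upwards [hsmall] with r hr
    have hv : 0 < v r := (mul_pos hc (Real.rpow_pos_of_pos hr.1 s)).trans_le (hlow r hr)
    exact le_log_div_log (hC0 r hr) hr hv (hup r hr)
  · filter_upwards [hsmall] with r hr
    exact log_div_log_le hc hr (hlow r hr)

theorem limsup_log_div_log_le {v : ℝ → ℝ} (hc : 0 < c) (hv : ∀ᶠ r in 𝓝[>] 0, c * r ^ s ≤ v r) :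
    limsup (fun r => ((Real.log (v r) / Real.log r : ℝ) : EReal)) (𝓝[>] 0) ≤ s := by
  have hup := (tendsto_const_div_log_nhdsGT_zero (Real.log c)).add_const s
  rw [zero_add] at hup
  refine (limsup_le_limsup ?_).trans_eq ((continuous_coe_real_ereal.tendsto s).comp hup).limsup_eq
  filter_upwards [hv, Ioo_mem_nhdsGT (zero_lt_one' ℝ)] with r hvr hr
  exact EReal.coe_le_coe_iff.2 (log_div_log_le hc hr hvr)

end LocalDimension

/-- The mass of small balls is bounded below because the derivative of the Haar measure with respect
to `μ` is finite `μ`-almost everywhere. -/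
theorem upperDim_le_finrank {E : Type*} [NormedAddCommGroup E] [NormedSpace ℝ E]
    [FiniteDimensional ℝ E] [MeasurableSpace E] [BorelSpace E] (μ : Measure E)
    [IsLocallyFiniteMeasure μ] : upperDim μ ≤ (Module.finrank ℝ E : ℝ) := by
  have : ProperSpace E := FiniteDimensional.proper_real E
  refine essSup_le_of_ae_le _ ?_
  filter_upwards [Besicovitch.ae_tendsto_rnDeriv Measure.addHaar μ,
    Measure.rnDeriv_lt_top (Measure.addHaar : Measure E) μ] with x hx hfin
  obtain ⟨M, hM⟩ := ENNReal.lt_iff_exists_nnreal_btwn.1 hfin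
  have hball : 0 < (Measure.addHaar : Measure E).real (Metric.ball 0 1) :=
    ENNReal.toReal_pos (Metric.measure_ball_pos _ _ one_pos).ne' measure_ball_lt_top.ne
  have hMpos : 0 < (M : ℝ) := NNReal.coe_pos.2 (ENNReal.coe_pos.1 (pos_of_gt hM.1))
  refine limsup_log_div_log_le (div_pos hball hMpos) ?_
  filter_upwards [hx.eventually_lt_const hM.1, self_mem_nhdsWithin] with r hr (hr0 : 0 < r)
  have hμ : μ (Metric.closedBall x r) ≠ ⊤ := measure_closedBall_lt_top.ne
  have hle : (Measure.addHaar : Measure E).real (Metric.closedBall x r) ≤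
      M * μ.real (Metric.closedBall x r) := by
    rw [measureReal_def, measureReal_def, ← ENNReal.coe_toReal, ← ENNReal.toReal_mul]
    exact ENNReal.toReal_mono (ENNReal.mul_ne_top ENNReal.coe_ne_top hμ)
      ((ENNReal.div_le_iff_le_mul (.inr ENNReal.coe_ne_top) (.inl hμ)).1 hr.le)
  rw [Measure.addHaar_real_closedBall _ _ hr0.le, mul_comm, mul_comm (M : ℝ)] at hle
  rwa [Real.rpow_natCast, div_mul_eq_mul_div, div_le_iff₀ hMpos]

/-! ### Dimension of the coded measure -/

theorem tendsto_log_one_sub_two_mul_div_atBot :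
    Tendsto (fun L : ℝ => Real.log (1 - 2 * L) / L) atBot (𝓝 0) := by
  have htop : Tendsto (fun L : ℝ => 1 - 2 * L) atBot atTop :=
    tendsto_atTop_add_const_left _ 1
      (tendsto_neg_atBot_atTop.comp (tendsto_id.const_mul_atBot two_pos))
  have hlog : Tendsto (fun L : ℝ => Real.log (1 - 2 * L) / (1 - 2 * L)) atBot (𝓝 0) :=
    Real.isLittleO_log_id_atTop.tendsto_div_nhds_zero.comp htop
  have hquot : Tendsto (fun L : ℝ => 1 / L - 2) atBot (𝓝 (0 - 2)) :=
    (tendsto_const_nhds.div_atBot tendsto_id).sub tendsto_const_nhds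
  have hmul := hlog.mul hquot
  rw [zero_mul] at hmul
  refine hmul.congr' ?_
  filter_upwards [eventually_lt_atBot 0] with L hL
  have : 1 - 2 * L ≠ 0 := by linarith
  have := hL.ne
  field_simp

theorem exists_dyadic_scale {r : ℝ} (hr : r ∈ Ioo 0 1) :
    ∃ n : ℕ, 1 < r * 2 ^ (n + 1) ∧ r * 2 ^ n ≤ 1 ∧ (n : ℝ) ≤ -2 * Real.log r := by
  obtain ⟨n, hlow, hup⟩ := exists_nat_pow_near_of_lt_one hr.1 hr.2.le
    (show (0 : ℝ) < 1 / 2 by norm_num) (by norm_num)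
  rw [one_div, inv_pow, inv_lt_iff_one_lt_mul₀ (by positivity)] at hlow
  rw [one_div, inv_pow, le_inv_comm₀ hr.1 (by positivity)] at hup
  have hle : r * 2 ^ n ≤ 1 :=
    (mul_le_mul_of_nonneg_left hup hr.1.le).trans_eq (mul_inv_cancel₀ hr.1.ne')
  refine ⟨n, by linarith, hle, ?_⟩
  have hlog := Real.log_nonpos (mul_nonneg hr.1.le (by positivity)) hle
  rw [Real.log_mul hr.1.ne' (by positivity), Real.log_pow] at hlog
  nlinarith [Real.log_two_gt_d9, (Nat.cast_nonneg n : (0 : ℝ) ≤ n)]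

section Points

variable (w : BitPairSeq) {n : ℕ} {r : ℝ}

theorem cellMass_le_codedMeasure_real_closedBall (hr : ((2 : ℝ) ^ n)⁻¹ ≤ r) :
    cellMass n ≤ codedMeasure.real (Metric.closedBall (codedPoint w) r) := by
  rw [codedMeasure_real_apply Metric.isClosed_closedBall.measurableSet, ← fairCoins_real_cell n w]
  refine measureReal_mono fun w' hw' => ((dist_pi_le_iff (by positivity)).2 fun c => ?_).trans hr
  exact Real.abs_ofDigits_sub_ofDigits_le (leadingDigits_eq_iff.1 (hw' c))

theorem le_codedMeasure_real_closedBall (hr : r ∈ Ioo 0 1) :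
    1 / 4 * r ^ 2 ≤ codedMeasure.real (Metric.closedBall (codedPoint w) r) := by
  obtain ⟨n, hlow, hup, -⟩ := exists_dyadic_scale hr
  have hrn : r ^ 2 * 4 ^ n ≤ 1 := by
    rw [show (4 : ℝ) = 2 ^ 2 by norm_num, ← pow_mul, mul_comm 2, pow_mul, ← mul_pow]
    exact pow_le_one₀ (mul_nonneg hr.1.le (by positivity)) hup
  have hmass := one_le_cellMass_mul_pow (n + 1)
  rw [pow_succ] at hmass
  refine (le_of_mul_le_mul_right (?_ : 1 / 4 * r ^ 2 * 4 ^ n ≤ cellMass (n + 1) * 4 ^ n)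
    (by positivity)).trans (cellMass_le_codedMeasure_real_closedBall w ?_)
  · linarith
  · exact (inv_le_iff_one_le_mul₀ (by positivity)).2 hlow.le

theorem codedMeasure_real_closedBall_le (hr : r ∈ Ioo 0 1) :
    codedMeasure.real (Metric.closedBall (codedPoint w) r) ≤
      128 * (1 - 2 * Real.log r) * r ^ 2 := by
  obtain ⟨n, hlow, hup, hn⟩ := exists_dyadic_scale hr
  have hr0 := hr.1
  have hrn : 1 ≤ 4 * r ^ 2 * 4 ^ n := by
    calc (1 : ℝ) ≤ (r * 2 ^ (n + 1)) ^ 2 := one_le_pow₀ hlow.le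
      _ = 4 * r ^ 2 * 4 ^ n := by
        rw [show (4 : ℝ) ^ n = (2 ^ n) ^ 2 by rw [← pow_mul, mul_comm, pow_mul]; norm_num]
        ring
  have hmass : cellMass n ≤ 8 * (1 - 2 * Real.log r) * r ^ 2 := by
    refine le_of_mul_le_mul_right ?_ (show (0 : ℝ) < 4 ^ n by positivity)
    have hlog : 0 ≤ 1 - 2 * Real.log r := by linarith [(Nat.cast_nonneg n : (0 : ℝ) ≤ n)]
    calc cellMass n * 4 ^ n ≤ 2 * (n + 1) := cellMass_mul_pow_le n
      _ ≤ 2 * (1 - 2 * Real.log r) * 1 := by linarith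
      _ ≤ 2 * (1 - 2 * Real.log r) * (4 * r ^ 2 * 4 ^ n) := by gcongr
      _ = 8 * (1 - 2 * Real.log r) * r ^ 2 * 4 ^ n := by ring
  have hside : ∀ x : ℝ, (x + r - (x - r)) * 2 ^ n + 2 = 2 * (r * 2 ^ n) + 2 := fun x => by ring
  rw [closedBall_eq_Icc_pi _ hr0.le]
  refine (codedMeasure_real_Icc_le n fun c => by linarith).trans ?_
  simp only [hside, Fin.prod_univ_two]
  calc cellMass n * ((2 * (r * 2 ^ n) + 2) * (2 * (r * 2 ^ n) + 2))
      ≤ cellMass n * ((2 * 1 + 2) * (2 * 1 + 2)) :=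
        mul_le_mul_of_nonneg_left (by gcongr) (cellMass_pos n).le
    _ ≤ 8 * (1 - 2 * Real.log r) * r ^ 2 * ((2 * 1 + 2) * (2 * 1 + 2)) := by gcongr
    _ = 128 * (1 - 2 * Real.log r) * r ^ 2 := by ring

theorem codedPoint_mem_support : codedPoint w ∈ codedMeasure.support := by
  rw [(Metric.nhds_basis_closedBall).mem_measureSupport]
  intro r hr
  obtain ⟨n, hn⟩ := exists_pow_lt_of_lt_one hr (show (1 / 2 : ℝ) < 1 by norm_num)
  rw [one_div, inv_pow] at hn
  exact (ENNReal.toReal_pos_iff.1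
    ((cellMass_pos n).trans_le (cellMass_le_codedMeasure_real_closedBall w hn.le))).1

end Points

theorem isCompact_range_codedPoint : IsCompact (range codedPoint) :=
  isCompact_range continuous_codedPoint

theorem ae_mem_range_codedPoint : ∀ᵐ z ∂codedMeasure, z ∈ range codedPoint :=
  (ae_map_iff measurable_codedPoint.aemeasurable
    isCompact_range_codedPoint.isClosed.measurableSet).2 (ae_of_all _ mem_range_self)

theorem support_codedMeasure_subset : codedMeasure.support ⊆ range codedPoint :=
  Measure.support_subset_of_isClosed isCompact_range_codedPoint.isClosed ae_mem_range_codedPoint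

theorem hasExactDim_codedMeasure : HasExactDim codedMeasure 2 := by
  filter_upwards [ae_mem_range_codedPoint]
  rintro _ ⟨w, rfl⟩
  have hlog : Tendsto (fun r => Real.log (128 * (1 - 2 * Real.log r)) / Real.log r) (𝓝[>] 0)
      (𝓝 0) := by
    have hsum := (tendsto_const_div_log_nhdsGT_zero (Real.log 128)).add
      (tendsto_log_one_sub_two_mul_div_atBot.comp Real.tendsto_log_nhdsGT_zero)
    rw [add_zero] at hsum
    refine hsum.congr' ?_
    filter_upwards [Ioo_mem_nhdsGT (zero_lt_one' ℝ)] with r hr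
    have := Real.log_neg hr.1 hr.2
    rw [Real.log_mul (by norm_num) (by linarith), add_div, Function.comp_apply]
  refine tendsto_log_div_log (c := 1 / 4) (by norm_num) hlog (fun r hr => ?_) (fun r hr => ?_)
    fun r hr => ?_
  · linarith [Real.log_neg hr.1 hr.2]
  · rw [Real.rpow_two]
    exact le_codedMeasure_real_closedBall w hr
  · rw [Real.rpow_two]
    exact codedMeasure_real_closedBall_le w hr
/-! ### Conditional measures -/

section CondExpKernel

variable {Ω β : Type*} {m mΩ : MeasurableSpace Ω} {μ : Measure Ω}

theorem ae_condExpKernel_eq_zero [StandardBorelSpace Ω] [IsFiniteMeasure μ] (hm : m ≤ mΩ)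
    {s t : Set Ω} (hs : MeasurableSet s) (ht : MeasurableSet[m] t) (hst : s =ᵐ[μ] t) :
    ∀ᵐ x ∂μ, x ∉ s → ProbabilityTheory.condExpKernel μ m x s = 0 := by
  have hcond : μ[t.indicator fun _ => (1 : ℝ) | m] = t.indicator fun _ => (1 : ℝ) :=
    condExp_of_stronglyMeasurable hm (stronglyMeasurable_const.indicator ht)
      ((integrable_const _).indicator (hm _ ht))
  filter_upwards [ProbabilityTheory.condExpKernel_ae_eq_condExp hm hs,
    condExp_congr_ae (m := m) (indicator_ae_eq_of_ae_eq_set (f := fun _ => (1 : ℝ)) hst),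
    hst.mem_iff] with x hkernel hindicator hmem hx
  rw [hcond, indicator_of_notMem (mt hmem.2 hx)] at hindicator
  exact (measureReal_eq_zero_iff (measure_ne_top _ _)).1 (hkernel.trans hindicator)

variable {f : Ω → β} {K : Set Ω}

theorem ae_eq_preimage_image_of_injOn (hμ : μ Kᶜ = 0) (hinj : InjOn f K) (s : Set Ω) :
    s =ᵐ[μ] f ⁻¹' (f '' (s ∩ K)) := by
  have hK : ∀ᵐ x ∂μ, x ∈ K := hμ
  filter_upwards [hK] with x hx
  refine propext ⟨fun h => ⟨x, ⟨h, hx⟩, rfl⟩, ?_⟩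
  rintro ⟨y, hy, hxy⟩
  exact hinj hy.2 hx hxy ▸ hy.1

/-- Up to null sets, an injective map generates the whole σ-algebra. -/
theorem ae_condExpKernel_comap_compl_singleton [StandardBorelSpace Ω] [IsFiniteMeasure μ]
    [mβ : MeasurableSpace β] [StandardBorelSpace β] (hf : Measurable f) (hK : MeasurableSet K)
    (hμ : μ Kᶜ = 0) (hinj : InjOn f K) :
    ∀ᵐ x ∂μ, ProbabilityTheory.condExpKernel μ (mβ.comap f) x {x}ᶜ = 0 := by
  have hnull : ∀ s, MeasurableSet s → ∀ᵐ x ∂μ, x ∉ s →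
      ProbabilityTheory.condExpKernel μ (mβ.comap f) x s = 0 :=
    fun s hs => ae_condExpKernel_eq_zero hf.comap_le hs
      ⟨_, (hs.inter hK).image_of_measurable_injOn hf (hinj.mono inter_subset_right), rfl⟩
      (ae_eq_preimage_image_of_injOn hμ hinj s)
  obtain ⟨S, hS, hsep⟩ := exists_seq_separating Ω MeasurableSet.empty univ
  filter_upwards [ae_all_iff.2 fun n => hnull _ (hS n),
    ae_all_iff.2 fun n => hnull _ (hS n).compl] with x hx hx'
  have hcover : {x}ᶜ ⊆ ⋃ n, {y | ¬(x ∈ S n ↔ y ∈ S n)} := fun y hy => by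
    by_contra hall
    simp only [mem_iUnion, mem_ofPred_eq, not_exists, not_not] at hall
    exact hy (hsep x trivial y trivial hall).symm
  refine measure_mono_null hcover (measure_iUnion_null fun n => ?_)
  by_cases hxn : x ∈ S n
  · refine measure_mono_null (fun y hy => ?_) (hx' n (not_not.2 hxn))
    simpa [hxn] using hy
  · refine measure_mono_null (fun y hy => ?_) (hx n hxn)
    simpa [hxn] using hy

end CondExpKernel

theorem upperDim_le_zero_of_compl_singleton {E : Type*} [PseudoMetricSpace E] [MeasurableSpace E]
    {μ : Measure E} {x : E} (h : μ {x}ᶜ = 0) : upperDim μ ≤ 0 := by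
  have hae : ∀ᵐ y ∂μ, y = x := h
  refine essSup_le_of_ae_le _ (hae.mono fun y hy => ?_)
  have hball : ∀ r ∈ Ioi (0 : ℝ), μ.real (Metric.closedBall x r) = μ.real univ := fun r hr =>
    measureReal_congr (ae_eq_univ.2 (measure_mono_null (compl_subset_compl.2
      (singleton_subset_iff.2 (Metric.mem_closedBall_self (le_of_lt hr)))) h))
  have hlim : Tendsto (localDimQuot μ x) (𝓝[>] 0) (𝓝 0) := by
    refine (tendsto_const_div_log_nhdsGT_zero (Real.log (μ.real univ))).congr' ?_
    filter_upwards [self_mem_nhdsWithin] with r hr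
    rw [localDimQuot, hball r hr]
  rw [hy]
  exact ((continuous_coe_real_ereal.tendsto 0).comp hlim).limsup_eq.le

theorem measurable_proj₁ : Measurable proj₁ := measurable_pi_apply 0

theorem ae_upperDim_add_lt : ∀ᵐ x ∂codedMeasure,
    upperDim (codedMeasure.map proj₁) + upperDim (fibreMeas codedMeasure x) <
      ((2 : ℝ) : EReal) := by
  have hproj : upperDim (codedMeasure.map proj₁) ≤ 1 := by
    have := Measure.isProbabilityMeasure_map (μ := codedMeasure) measurable_proj₁.aemeasurable
    simpa using upperDim_le_finrank (codedMeasure.map proj₁)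
  filter_upwards [ae_condExpKernel_comap_compl_singleton measurable_proj₁
    isCompact_range_codedPoint.isClosed.measurableSet ae_mem_range_codedPoint
    injOn_proj₁_range_codedPoint] with x hx
  have hsum := add_le_add hproj (upperDim_le_zero_of_compl_singleton hx)
  rw [add_zero] at hsum
  exact hsum.trans_lt (by exact_mod_cast one_lt_two (α := ℝ))
/-! ### Sceneries on boxes -/

section BoxNorm

variable {d : ℕ} {μ : Measure (Fin d → ℝ)}

theorem smul_comap_coe_unitBall_apply (c : ℝ≥0∞) {s : Set (Fin d → ℝ)}
    (hs : s ⊆ Metric.closedBall 0 1) :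
    (c • μ.comap ((↑) : Metric.closedBall (0 : Fin d → ℝ) 1 → Fin d → ℝ)) ((↑) ⁻¹' s) =
      c * μ s := by
  rw [Measure.smul_apply, smul_eq_mul,
    comap_subtype_coe_apply Metric.isClosed_closedBall.measurableSet, Subtype.image_preimage_coe,
    inter_eq_right.2 hs]

theorem boxNorm_real_apply (h0 : μ (Metric.closedBall 0 1) ≠ 0)
    (htop : μ (Metric.closedBall 0 1) ≠ ⊤) {s : Set (Fin d → ℝ)}
    (hs : s ⊆ Metric.closedBall 0 1) :
    (boxNorm μ : Measure (Metric.closedBall (0 : Fin d → ℝ) 1)).real ((↑) ⁻¹' s) =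
      μ.real s / μ.real (Metric.closedBall 0 1) := by
  have hprob : IsProbabilityMeasure ((μ (Metric.closedBall 0 1))⁻¹ •
      μ.comap ((↑) : Metric.closedBall (0 : Fin d → ℝ) 1 → Fin d → ℝ)) := ⟨by
    rw [← Subtype.coe_preimage_self, smul_comap_coe_unitBall_apply _ subset_rfl,
      ENNReal.inv_mul_cancel h0 htop]⟩
  have hcoe : (boxNorm μ : Measure (Metric.closedBall (0 : Fin d → ℝ) 1)) =
      (μ (Metric.closedBall 0 1))⁻¹ • μ.comap ((↑) : Metric.closedBall (0 : Fin d → ℝ) 1 → _) :=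
    if_pos hprob
  rw [measureReal_def, hcoe, smul_comap_coe_unitBall_apply _ hs, ENNReal.toReal_mul,
    ENNReal.toReal_inv, div_eq_inv_mul]
  rfl

end BoxNorm

theorem closedBall_zero_one_eq_Icc {ι : Type*} [Fintype ι] :
    Metric.closedBall (0 : ι → ℝ) 1 = Icc (-1) 1 := by
  rw [closedBall_eq_Icc_pi _ zero_le_one]
  congr 1 <;> ext <;> simp

theorem Icc_subset_closedBall_zero_one {ι : Type*} [Fintype ι] {a b : ι → ℝ} (ha : -1 ≤ a)
    (hb : b ≤ 1) : Icc a b ⊆ Metric.closedBall 0 1 :=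
  (Icc_subset_Icc ha hb).trans closedBall_zero_one_eq_Icc.ge

section Boxes

variable {d : ℕ} {a b : Fin d → ℝ}

theorem boxNorm_normLebesgue_real_Icc (ha : -1 ≤ a) (hab : a ≤ b) (hb : b ≤ 1) :
    (boxNorm (normLebesgue d) : Measure (Metric.closedBall (0 : Fin d → ℝ) 1)).real
      ((↑) ⁻¹' Icc a b) = ∏ i, (b i - a i) / 2 := by
  rw [boxNorm_real_apply (by simp [normLebesgue_unitBall]) (by simp [normLebesgue_unitBall])
      (Icc_subset_closedBall_zero_one ha hb),
    measureReal_def _ (Metric.closedBall _ _), normLebesgue_unitBall, normLebesgue, starNorm,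
    measureReal_ennreal_smul_apply, measureReal_def, Real.volume_Icc_pi_toReal hab,
    Real.volume_pi_closedBall _ zero_le_one, Finset.prod_div_distrib]
  simp [div_eq_inv_mul]

/-- The image of the box `Icc a b` under `y ↦ z + e⁻ᵗ y`, the preimage of `Icc a b` under the
magnification of time `t` at `z`. -/
def scaledBox (z : Fin d → ℝ) (t : ℝ) (a b : Fin d → ℝ) : Set (Fin d → ℝ) :=
  Icc (z + Real.exp (-t) • a) (z + Real.exp (-t) • b)

theorem scaledBox_neg_one_one (z : Fin d → ℝ) (t : ℝ) :
    scaledBox z t (-1) 1 = Metric.closedBall z (Real.exp (-t)) := by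
  rw [closedBall_eq_Icc_pi _ (Real.exp_pos _).le, scaledBox]
  congr 1 <;> ext <;> simp [sub_eq_add_neg]

variable {μ : Measure (Fin d → ℝ)} {z : Fin d → ℝ} {t : ℝ}

theorem scaleMeas_translateMeas_Icc :
    scaleMeas t (translateMeas z μ) (Icc a b) = μ (scaledBox z t a b) := by
  rw [scaleMeas, translateMeas, Measure.map_map (by fun_prop) (by fun_prop),
    Measure.map_apply (by fun_prop) measurableSet_Icc]
  congr 1
  ext y
  have hexp := Real.exp_pos t
  simp only [mem_preimage, Function.comp_apply, scaledBox, mem_Icc, Real.exp_neg,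
    ← le_sub_iff_add_le', ← sub_le_iff_le_add', inv_smul_le_iff_of_pos hexp,
    le_inv_smul_iff_of_pos hexp]

theorem scenery_real_Icc [IsFiniteMeasure μ] (h0 : μ (Metric.closedBall z (Real.exp (-t))) ≠ 0)
    (ha : -1 ≤ a) (hb : b ≤ 1) :
    (scenery μ z t : Measure (Metric.closedBall (0 : Fin d → ℝ) 1)).real ((↑) ⁻¹' Icc a b) =
      μ.real (scaledBox z t a b) / μ.real (scaledBox z t (-1) 1) := by
  have hball : scaleMeas t (translateMeas z μ) (Metric.closedBall 0 1) =
      μ (scaledBox z t (-1) 1) := by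
    rw [closedBall_zero_one_eq_Icc, scaleMeas_translateMeas_Icc]
  rw [scenery, boxNorm_real_apply, measureReal_def, measureReal_def, hball,
    scaleMeas_translateMeas_Icc]
  · rfl
  · rwa [hball, scaledBox_neg_one_one]
  · exact hball ▸ measure_ne_top _ _
  · exact Icc_subset_closedBall_zero_one ha hb

end Boxes

theorem tendsto_probabilityMeasure_of_tendsto_Icc {d : ℕ} {ι : Type*} {l : Filter ι}
    [l.IsCountablyGenerated] {ν : ι → ProbabilityMeasure (Metric.closedBall (0 : Fin d → ℝ) 1)}
    {ν₀ : ProbabilityMeasure (Metric.closedBall (0 : Fin d → ℝ) 1)}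
    (h : ∀ a b : Fin d → ℝ, -1 ≤ a → a ≤ b → b ≤ 1 →
      Tendsto (fun i => (ν i : Measure (Metric.closedBall (0 : Fin d → ℝ) 1)).real
        ((↑) ⁻¹' Icc a b)) l
        (𝓝 ((ν₀ : Measure (Metric.closedBall (0 : Fin d → ℝ) 1)).real ((↑) ⁻¹' Icc a b)))) :
    Tendsto ν l (𝓝 ν₀) := by
  let boxes : Set (Set (Metric.closedBall (0 : Fin d → ℝ) 1)) :=
    {s | ∃ a b : Fin d → ℝ, -1 ≤ a ∧ a ≤ b ∧ b ≤ 1 ∧ s = (↑) ⁻¹' Icc a b}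
  have hboxes : IsPiSystem boxes := by
    rintro _ ⟨a, b, ha, -, hb, rfl⟩ _ ⟨a', b', -, -, -, rfl⟩ hne
    rw [← preimage_inter, Icc_inter_Icc] at hne ⊢
    obtain ⟨x, hx⟩ := hne
    exact ⟨_, _, ha.trans le_sup_left, hx.1.trans hx.2, inf_le_left.trans hb, rfl⟩
  refine hboxes.tendsto_probabilityMeasure_of_tendsto_of_mem ?_ ?_ ?_
  · rintro _ ⟨a, b, -, -, -, rfl⟩
    exact measurable_subtype_coe measurableSet_Icc
  · intro u hu x hx
    obtain ⟨ε, hε, hsub⟩ := Metric.nhds_basis_closedBall.mem_iff.1 (hu.mem_nhds hx)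
    have hball : ((↑) ⁻¹' Icc ((-1) ⊔ fun i => (x : Fin d → ℝ) i - ε)
        (1 ⊓ fun i => (x : Fin d → ℝ) i + ε) : Set (Metric.closedBall (0 : Fin d → ℝ) 1)) =
          Metric.closedBall x ε := by
      rw [← Icc_inter_Icc, ← closedBall_zero_one_eq_Icc, ← closedBall_eq_Icc_pi _ hε.le]
      exact ext fun y => ⟨fun hy => hy.2, fun hy => ⟨y.2, hy⟩⟩
    have hself := hball ▸ Metric.mem_closedBall_self (x := x) hε.le
    exact ⟨_, ⟨_, _, le_sup_left, hself.1.trans hself.2, inf_le_left, hball.symm⟩,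
      Metric.closedBall_mem_nhds x hε, hsub⟩
  · rintro _ ⟨a, b, ha, hab, hb, rfl⟩
    exact NNReal.tendsto_coe.1 (h a b ha hab hb)

section Continuity

variable {T ι : Type*} [TopologicalSpace T]

theorem eventually_le_iff_of_continuous_of_ne {f g : T → ℝ} (hf : Continuous f)
    (hg : Continuous g) {t₀ : T} (h : f t₀ ≠ g t₀) :
    ∀ᶠ t in 𝓝 t₀, (f t ≤ g t ↔ f t₀ ≤ g t₀) := by
  rcases lt_or_gt_of_ne h with h | h
  · filter_upwards [hf.continuousAt.eventually_lt hg.continuousAt h] with t ht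
    exact iff_of_true ht.le h.le
  · filter_upwards [hg.continuousAt.eventually_lt hf.continuousAt h] with t ht
    exact iff_of_false ht.not_ge h.not_ge

theorem continuous_measureReal_Icc [FirstCountableTopology T] [Finite ι] {μ : Measure (ι → ℝ)}
    [IsFiniteMeasure μ] (hμ : ∀ i y, μ {z | z i = y} = 0) {a b : T → ι → ℝ} (ha : Continuous a)
    (hb : Continuous b) : Continuous fun t => μ.real (Icc (a t) (b t)) := by
  refine continuous_iff_continuousAt.2 fun t₀ => (ENNReal.tendsto_toReal (measure_ne_top _ _)).comp
    (tendsto_measure_of_ae_tendsto_indicator_of_isFiniteMeasure _ measurableSet_Icc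
      (fun _ => measurableSet_Icc) ?_)
  have hne : ∀ i c, ∀ᵐ y ∂μ, y i ≠ c := fun i c => by
    rw [ae_iff]
    simpa only [not_not] using hμ i c
  have hboundary : ∀ᵐ y ∂μ, ∀ i, y i ≠ a t₀ i ∧ y i ≠ b t₀ i :=
    eventually_countable_forall.2 fun i => (hne i _).and (hne i _)
  filter_upwards [hboundary] with y hy
  have hai := fun i => eventually_le_iff_of_continuous_of_ne ((continuous_apply i).comp ha)
    continuous_const (hy i).1.symm
  have hbi := fun i => eventually_le_iff_of_continuous_of_ne continuous_const
    ((continuous_apply i).comp hb) (hy i).2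
  filter_upwards [eventually_all.2 hai, eventually_all.2 hbi] with t hat hbt
  exact and_congr (forall_congr' hat) (forall_congr' hbt)

end Continuity

theorem continuous_scenery {d : ℕ} {μ : Measure (Fin d → ℝ)} [IsFiniteMeasure μ]
    (hμ : ∀ i y, μ {z | z i = y} = 0) {z : Fin d → ℝ} (hz : z ∈ μ.support) :
    Continuous (scenery μ z) := by
  have hball : ∀ t, μ (Metric.closedBall z (Real.exp (-t))) ≠ 0 := fun t =>
    (Metric.nhds_basis_closedBall.mem_measureSupport.1 hz _ (Real.exp_pos _)).ne'
  have hcont : ∀ a b, Continuous fun t => μ.real (scaledBox z t a b) := fun a b =>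
    continuous_measureReal_Icc hμ (by fun_prop) (by fun_prop)
  refine continuous_iff_continuousAt.2 fun t₀ =>
    tendsto_probabilityMeasure_of_tendsto_Icc fun a b ha _ hb => ?_
  simp only [scenery_real_Icc (hball _) ha hb]
  refine ((hcont a b).tendsto t₀).div ((hcont _ _).tendsto t₀) ?_
  rw [scaledBox_neg_one_one]
  exact (measureReal_eq_zero_iff (measure_ne_top _ _)).not.2 (hball t₀)
/-! ### Sceneries between coding positions -/

/-- The times at which the magnified ball has radius `exp (-t)` between `2 ^ j / 2 ^ 2 ^ (j + 1)`
and `1 / (2 ^ j * 2 ^ (2 ^ j + 1))`, well between the coding positions `2 ^ j` and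
`2 ^ (j + 1)`. -/
noncomputable def goodTimes (j : ℕ) : Set ℝ :=
  Icc ((2 ^ j + 1 + j) * Real.log 2) ((2 ^ (j + 1) - j) * Real.log 2)

/-- The set of points that, within their dyadic square of level `2 ^ j + 1`, the first one which
does not depend on the digits at the coding position `2 ^ j`, are at relative distance at least
`1 / 2 ^ j` from the boundary of that square. -/
def centralPoints (j : ℕ) : Set (Fin 2 → ℝ) :=
  {z | ∀ c, Int.fract (z c * 2 ^ (2 ^ j + 1)) ∈ Icc ((2 : ℝ) ^ j)⁻¹ (1 - ((2 : ℝ) ^ j)⁻¹)}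

theorem measurableSet_centralPoints (j : ℕ) : MeasurableSet (centralPoints j) := by
  simp only [centralPoints, ofPred_forall]
  exact MeasurableSet.iInter fun c =>
    (measurable_fract.comp ((measurable_pi_apply c).mul_const _)) measurableSet_Icc

theorem fract_mem_Icc_iff {x ε : ℝ} (hx : x ∈ Icc 0 1) (hε : 0 < ε) :
    Int.fract x ∈ Icc ε (1 - ε) ↔ x ∈ Icc ε (1 - ε) := by
  rcases hx.2.eq_or_lt with rfl | hlt
  · simp only [Int.fract_one, mem_Icc]
    constructor <;> rintro ⟨_, _⟩ <;> linarith
  · rw [Int.fract_eq_self.2 ⟨hx.1, hlt⟩]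

theorem codedPoint_mem_centralPoints_iff {w : BitPairSeq} {j : ℕ} :
    codedPoint w ∈ centralPoints j ↔
      ∀ c, Real.ofDigits (fun i => codedDigits w c (i + (2 ^ j + 1))) ∈
        Icc ((2 : ℝ) ^ j)⁻¹ (1 - ((2 : ℝ) ^ j)⁻¹) := by
  refine forall_congr' fun c => ?_
  have hsplit := ofDigits_mul_pow (codedDigits w c) (2 ^ j + 1)
  rw [Nat.cast_ofNat] at hsplit
  rw [codedPoint, hsplit, Int.fract_natCast_add, fract_mem_Icc_iff
    ⟨Real.ofDigits_nonneg _, Real.ofDigits_le_one _⟩ (by positivity)]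

theorem not_isCoding_of_mem_Ioo {j l : ℕ} (h : l ∈ Ioo (2 ^ j) (2 ^ (j + 1))) : ¬IsCoding l := by
  rw [IsCoding, Nat.log_eq_of_pow_le_of_lt_pow h.1.le h.2]
  exact h.1.ne

theorem two_pow_eq_exp (n : ℕ) : (2 : ℝ) ^ n = Real.exp (n * Real.log 2) := by
  rw [Real.exp_nat_mul, Real.exp_log two_pos]

section GoodTimes

variable {j : ℕ} {t : ℝ}

theorem exp_neg_mul_le_of_mem_goodTimes (ht : t ∈ goodTimes j) :
    Real.exp (-t) * 2 ^ (2 ^ j + 1) ≤ ((2 : ℝ) ^ j)⁻¹ := by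
  rw [two_pow_eq_exp, two_pow_eq_exp, ← Real.exp_neg, ← Real.exp_add, Real.exp_le_exp]
  have := ht.1
  push_cast
  linarith

theorem le_exp_neg_mul_of_mem_goodTimes (ht : t ∈ goodTimes j) :
    2 ^ j ≤ Real.exp (-t) * 2 ^ 2 ^ (j + 1) := by
  rw [two_pow_eq_exp, two_pow_eq_exp (2 ^ (j + 1)), ← Real.exp_add, Real.exp_le_exp]
  have := ht.2
  push_cast
  linarith

theorem eventually_forall_mem_goodTimes_le (J : ℕ) :
    ∀ᶠ t in atTop, ∀ j, t ∈ goodTimes j → J ≤ j := by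
  filter_upwards [eventually_gt_atTop ((2 : ℝ) ^ J * Real.log 2)] with t ht j hj
  by_contra! hlt
  have hpow : (2 : ℝ) ^ (j + 1) ≤ 2 ^ J := pow_le_pow_right₀ one_le_two hlt
  refine (hj.2.trans (mul_le_mul_of_nonneg_right ?_ (Real.log_nonneg one_le_two))).not_gt ht
  linarith [Nat.cast_nonneg (α := ℝ) j]

variable {a b : Fin 2 → ℝ}

theorem add_smul_sub_add_smul_mul (z : Fin 2 → ℝ) (r s : ℝ) (c : Fin 2) :
    ((z + r • b) c - (z + r • a) c) * s = (b c - a c) * (r * s) := by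
  simp only [Pi.add_apply, Pi.smul_apply, smul_eq_mul]
  ring

theorem codedMeasure_real_scaledBox_le (z : Fin 2 → ℝ) (t : ℝ) (n : ℕ) (hab : a ≤ b) :
    codedMeasure.real (scaledBox z t a b) ≤
      cellMass n * ∏ c, ((b c - a c) * (Real.exp (-t) * 2 ^ n) + 2) := by
  have hle : z + Real.exp (-t) • a ≤ z + Real.exp (-t) • b := by gcongr
  simpa only [scaledBox, add_smul_sub_add_smul_mul] using codedMeasure_real_Icc_le n hle

theorem le_codedMeasure_real_scaledBox {w : BitPairSeq} (hw : codedPoint w ∈ centralPoints j)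
    (ht : t ∈ goodTimes j) (ha : -1 ≤ a) (hb : b ≤ 1) :
    cellMass (2 ^ (j + 1)) * ∏ c, max 0 ((b c - a c) * (Real.exp (-t) * 2 ^ 2 ^ (j + 1)) - 2) ≤
      codedMeasure.real (scaledBox (codedPoint w) t a b) := by
  have hlevel : 2 ^ j + 1 + (2 ^ j - 1) = 2 ^ (j + 1) := by
    have := Nat.one_le_two_pow (n := j)
    rw [pow_succ]
    omega
  have hfree : ∀ l ∈ Ico (2 ^ j + 1) (2 ^ j + 1 + (2 ^ j - 1)), ¬IsCoding l := fun l hl =>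
    not_isCoding_of_mem_Ioo ⟨hl.1, hlevel ▸ hl.2⟩
  have hscale := exp_neg_mul_le_of_mem_goodTimes ht
  have hscale0 : 0 ≤ Real.exp (-t) * 2 ^ (2 ^ j + 1) := by positivity
  have hsplit := fun c => ofDigits_mul_pow (codedDigits w c) (2 ^ j + 1)
  have hlow : ∀ c, leadingDigits (codedDigits w c) (2 ^ j + 1) ≤
      (codedPoint w + Real.exp (-t) • a) c * 2 ^ (2 ^ j + 1) := fun c => by
    have := (codedPoint_mem_centralPoints_iff.1 hw c).1
    have := mul_le_mul_of_nonneg_left (ha c) hscale0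
    simp only [Pi.add_apply, Pi.smul_apply, smul_eq_mul, codedPoint, Pi.neg_apply, Pi.one_apply,
      Nat.cast_ofNat] at *
    linarith [hsplit c]
  have hup : ∀ c, (codedPoint w + Real.exp (-t) • b) c * 2 ^ (2 ^ j + 1) ≤
      leadingDigits (codedDigits w c) (2 ^ j + 1) + 1 := fun c => by
    have := (codedPoint_mem_centralPoints_iff.1 hw c).2
    have := mul_le_mul_of_nonneg_left (hb c) hscale0
    simp only [Pi.add_apply, Pi.smul_apply, smul_eq_mul, codedPoint, Pi.one_apply,
      Nat.cast_ofNat] at *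
    linarith [hsplit c]
  simpa only [scaledBox, hlevel, add_smul_sub_add_smul_mul] using
    le_codedMeasure_real_Icc hfree w hlow hup

/-- Both box masses are, up to boundary effects, multiples of the same cell mass. -/
theorem codedMeasure_scaledBox_ratio_mem_Icc {w : BitPairSeq}
    (hw : codedPoint w ∈ centralPoints j) (ht : t ∈ goodTimes j) (ha : -1 ≤ a) (hab : a ≤ b)
    (hb : b ≤ 1) {N : ℝ} (hN : N = Real.exp (-t) * 2 ^ 2 ^ (j + 1)) (hN1 : 1 < N) :
    codedMeasure.real (scaledBox (codedPoint w) t a b) /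
        codedMeasure.real (scaledBox (codedPoint w) t (-1) 1) ∈
      Icc (∏ c, max 0 ((b c - a c) * N - 2) / (2 * N + 2))
        (∏ c, ((b c - a c) * N + 2) / (2 * N - 2)) := by
  have hM := cellMass_pos (2 ^ (j + 1))
  have hunit : ∀ c : Fin 2, (1 : Fin 2 → ℝ) c - (-1 : Fin 2 → ℝ) c = 2 := fun c => by norm_num
  have hlow := le_codedMeasure_real_scaledBox hw ht ha hb
  have hup := codedMeasure_real_scaledBox_le (codedPoint w) t (2 ^ (j + 1)) hab
  have hlow1 := le_codedMeasure_real_scaledBox hw ht (le_refl (-1)) (le_refl 1)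
  have hup1 := codedMeasure_real_scaledBox_le (codedPoint w) t (2 ^ (j + 1))
    (show (-1 : Fin 2 → ℝ) ≤ 1 from fun _ => by norm_num)
  simp only [hunit, ← hN] at hlow hup hlow1 hup1
  rw [max_eq_right (by linarith)] at hlow1
  have hden : 0 < ∏ _c : Fin 2, (2 * N - 2) := Finset.prod_pos fun _ _ => by linarith
  have hwidth : ∀ c, 0 ≤ (b c - a c) * N := fun c =>
    mul_nonneg (sub_nonneg.2 (hab c)) (zero_le_one.trans hN1.le)
  rw [Finset.prod_div_distrib, Finset.prod_div_distrib, ← mul_div_mul_left _ _ hM.ne',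
    ← mul_div_mul_left (∏ c, ((b c - a c) * N + 2)) _ hM.ne']
  exact ⟨div_le_div₀ measureReal_nonneg hlow ((mul_pos hM hden).trans_le hlow1) hup1,
    div_le_div₀ (mul_nonneg hM.le (Finset.prod_nonneg fun c _ => add_nonneg (hwidth c) two_pos.le))
      hup (mul_pos hM hden) hlow1⟩

end GoodTimes

theorem tendsto_mul_add_div_mul_add_atTop (β c c' : ℝ) {γ : ℝ} (hγ : γ ≠ 0) :
    Tendsto (fun N : ℝ => (β * N + c) / (γ * N + c')) atTop (𝓝 (β / γ)) := by
  have hlinear : ∀ s e : ℝ, Tendsto (fun N : ℝ => s + e / N) atTop (𝓝 s) := fun s e => by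
    simpa only [add_zero, id] using
      (tendsto_const_nhds (x := s)).add ((tendsto_const_nhds (x := e)).div_atTop tendsto_id)
  refine ((hlinear β c).div (hlinear γ c') hγ).congr' ?_
  filter_upwards [eventually_gt_atTop 0] with N hN
  rw [Pi.div_apply, ← mul_div_mul_right _ _ hN.ne', add_mul, add_mul, div_mul_cancel₀ _ hN.ne',
    div_mul_cancel₀ _ hN.ne']

theorem tendsto_prod_mul_add_div {ι : Type*} [Fintype ι] (s : ι → ℝ) :
    Tendsto (fun N : ℝ => ∏ c, (s c * N + 2) / (2 * N - 2)) atTop (𝓝 (∏ c, s c / 2)) :=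
  tendsto_finsetProd _ fun c _ => by
    simpa only [sub_eq_add_neg] using tendsto_mul_add_div_mul_add_atTop (s c) 2 (-2) two_ne_zero

theorem tendsto_prod_max_mul_sub_div {ι : Type*} [Fintype ι] {s : ι → ℝ} (hs : 0 ≤ s) :
    Tendsto (fun N : ℝ => ∏ c, max 0 (s c * N - 2) / (2 * N + 2)) atTop (𝓝 (∏ c, s c / 2)) := by
  refine tendsto_finsetProd _ fun c _ => ?_
  have hmax := (tendsto_const_nhds (x := (0 : ℝ))).max
    (tendsto_mul_add_div_mul_add_atTop (s c) (-2) 2 two_ne_zero)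
  rw [max_eq_right (div_nonneg (hs c) two_pos.le)] at hmax
  refine hmax.congr' ?_
  filter_upwards [eventually_gt_atTop 0] with N hN
  rw [← max_div_div_right (by positivity), zero_div, sub_eq_add_neg]

theorem tendsto_of_eventually_exists_mem_Icc {α β γ : Type*} {l : Filter α} [Preorder γ]
    [IsDirectedOrder γ] [Nonempty γ] [TopologicalSpace β] [LinearOrder β] [OrderTopology β]
    {q : α → β} {L U : γ → β} {x : β} (hL : Tendsto L atTop (𝓝 x)) (hU : Tendsto U atTop (𝓝 x))
    (h : ∀ N₀, ∀ᶠ t in l, ∃ N ≥ N₀, q t ∈ Icc (L N) (U N)) : Tendsto q l (𝓝 x) := by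
  refine tendsto_order.2 ⟨fun y hy => ?_, fun y hy => ?_⟩
  · obtain ⟨N₀, hN₀⟩ := eventually_atTop.1 ((tendsto_order.1 hL).1 y hy)
    filter_upwards [h N₀] with t ⟨N, hN, hq⟩ using (hN₀ N hN).trans_le hq.1
  · obtain ⟨N₀, hN₀⟩ := eventually_atTop.1 ((tendsto_order.1 hU).2 y hy)
    filter_upwards [h N₀] with t ⟨N, hN, hq⟩ using hq.2.trans_lt (hN₀ N hN)

theorem tendsto_scenery_goodTimes {w : BitPairSeq}
    (hw : ∀ᶠ j in atTop, codedPoint w ∈ centralPoints j) :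
    Tendsto (scenery codedMeasure (codedPoint w)) (atTop ⊓ 𝓟 (⋃ j, goodTimes j))
      (𝓝 (boxNorm (normLebesgue 2))) := by
  refine tendsto_probabilityMeasure_of_tendsto_Icc fun a b ha hab hb => ?_
  have hball : ∀ t, codedMeasure (Metric.closedBall (codedPoint w) (Real.exp (-t))) ≠ 0 := fun t =>
    (Metric.nhds_basis_closedBall.mem_measureSupport.1 (codedPoint_mem_support w) _
      (Real.exp_pos _)).ne'
  simp only [scenery_real_Icc (hball _) ha hb, boxNorm_normLebesgue_real_Icc ha hab hb]
  refine tendsto_of_eventually_exists_mem_Icc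
    (tendsto_prod_max_mul_sub_div (s := fun c => b c - a c) fun c => sub_nonneg.2 (hab c))
    (tendsto_prod_mul_add_div _) fun N₀ => ?_
  obtain ⟨J, hJ⟩ := eventually_atTop.1
    (hw.and ((tendsto_pow_atTop_atTop_of_one_lt (one_lt_two (α := ℝ))).eventually_gt_atTop
      (max N₀ 1)))
  rw [eventually_inf_principal]
  filter_upwards [eventually_forall_mem_goodTimes_le J] with t hlarge ht
  obtain ⟨j, hj⟩ := mem_iUnion.1 ht
  obtain ⟨hcentral, hpow⟩ := hJ j (hlarge j hj)
  have hscale := hpow.trans_le (le_exp_neg_mul_of_mem_goodTimes hj)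
  exact ⟨_, ((le_max_left _ _).trans_lt hscale).le, codedMeasure_scaledBox_ratio_mem_Icc hcentral hj
    ha hab hb rfl ((le_max_right _ _).trans_lt hscale)⟩
/-! ### Typical points are central -/

theorem fairCoins_real_forall_codedDigits_eq {s : Finset ℕ} (hs : ∀ i ∈ s, ¬IsCoding i)
    (c e : Fin 2) : fairCoins.real {w | ∀ i ∈ s, codedDigits w c i = e} = (1 / 2) ^ s.card := by
  have hpi : {w : BitPairSeq | ∀ i ∈ s, codedDigits w c i = e} = Set.pi s fun _ =>
      (({p : Fin 2 × Fin 2 | ![p.1, p.2] c = e} : Finset (Fin 2 × Fin 2)) :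
        Set (Fin 2 × Fin 2)) := by
    ext w
    simp only [mem_ofPred_eq, Set.mem_pi, Finset.mem_coe, Finset.mem_filter_univ]
    exact forall₂_congr fun i hi => by rw [codedDigits_of_not_isCoding _ (hs i hi)]
  have hcard : ∀ c e : Fin 2,
      ({p : Fin 2 × Fin 2 | ![p.1, p.2] c = e} : Finset (Fin 2 × Fin 2)).card = 2 := by
    decide
  rw [hpi, fairCoins_real_pi, hcard, Finset.prod_const]
  norm_num

/-- The event that some coordinate repeats one digit `j` times right after the coding position
`2 ^ j`. -/
def constantRun (j : ℕ) : Set BitPairSeq :=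
  {w | ∃ c e, ∀ i ∈ Finset.Ico (2 ^ j + 1) (2 ^ j + 1 + j), codedDigits w c i = e}

theorem fairCoins_constantRun_le (j : ℕ) :
    fairCoins (constantRun j) ≤ ENNReal.ofReal (4 * (1 / 2) ^ j) := by
  have hfree : ∀ i ∈ Finset.Ico (2 ^ j + 1) (2 ^ j + 1 + j), ¬IsCoding i := fun i hi => by
    have := Nat.lt_two_pow_self (n := j)
    rw [Finset.mem_Ico] at hi
    exact not_isCoding_of_mem_Ioo ⟨hi.1, by rw [pow_succ]; omega⟩
  have hunion : constantRun j = ⋃ p : Fin 2 × Fin 2,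
      {w | ∀ i ∈ Finset.Ico (2 ^ j + 1) (2 ^ j + 1 + j), codedDigits w p.1 i = p.2} := by
    ext w
    simp only [constantRun, mem_ofPred_eq, mem_iUnion, Prod.exists]
  rw [← ofReal_measureReal, hunion]
  refine ENNReal.ofReal_le_ofReal ((measureReal_iUnion_fintype_le _).trans_eq ?_)
  simp only [fairCoins_real_forall_codedDigits_eq hfree, Nat.card_Ico, Nat.add_sub_cancel_left,
    Finset.sum_const, Finset.card_univ, Fintype.card_prod, Fintype.card_fin, nsmul_eq_mul]
  norm_num

theorem codedPoint_mem_centralPoints {w : BitPairSeq} {j : ℕ} (hw : w ∉ constantRun j) :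
    codedPoint w ∈ centralPoints j := by
  have hrun : ∀ c e, ∃ i < j, codedDigits w c (i + (2 ^ j + 1)) ≠ e := fun c e => by
    by_contra! hconst
    refine hw ⟨c, e, fun i hi => ?_⟩
    rw [Finset.mem_Ico] at hi
    simpa only [Nat.sub_add_cancel hi.1] using hconst (i - (2 ^ j + 1)) (by omega)
  refine codedPoint_mem_centralPoints_iff.2 fun c => ⟨?_, ?_⟩
  · obtain ⟨i, hi, hne⟩ := hrun c 0
    exact_mod_cast inv_pow_le_ofDigits (a := fun i => codedDigits w c (i + (2 ^ j + 1))) hi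
      (by omega)
  · obtain ⟨i, hi, hne⟩ := hrun c 1
    exact_mod_cast ofDigits_le_one_sub (a := fun i => codedDigits w c (i + (2 ^ j + 1))) hi
      (by omega)

theorem ae_eventually_mem_centralPoints :
    ∀ᵐ z ∂codedMeasure, ∀ᶠ j in atTop, z ∈ centralPoints j := by
  have hmeas : MeasurableSet {z : Fin 2 → ℝ | ∀ᶠ j in atTop, z ∈ centralPoints j} := by
    convert MeasurableSet.measurableSet_liminf measurableSet_centralPoints
    ext z
    rw [mem_liminf_iff_eventually_mem]
    rfl
  have hsum : ∑' j, fairCoins (constantRun j) ≠ ⊤ := by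
    have hgeom : Summable fun j : ℕ => 4 * (1 / 2 : ℝ) ^ j := summable_geometric_two.mul_left 4
    refine ne_top_of_le_ne_top ?_ (ENNReal.tsum_le_tsum fairCoins_constantRun_le)
    rw [← ENNReal.ofReal_tsum_of_nonneg (fun j => by positivity) hgeom]
    exact ENNReal.ofReal_ne_top
  refine (ae_map_iff measurable_codedPoint.aemeasurable hmeas).2 ?_
  filter_upwards [ae_eventually_notMem hsum] with w hw
  exact hw.mono fun j hj => codedPoint_mem_centralPoints hj
/-! ### Time averages -/

theorem volume_sdiff_goodTimes_le (J : ℕ) :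
    volume.real (Ioc 0 ((2 ^ J + 1 + J) * Real.log 2) \ ⋃ j, goodTimes j) ≤ ((J : ℝ) + 2) ^ 2 := by
  have hlog : Real.log 2 ≤ 1 := by linarith [Real.log_two_lt_d9]
  induction J with
  | zero =>
    refine (measureReal_mono sdiff_subset measure_Ioc_lt_top.ne).trans ?_
    rw [Real.volume_real_Ioc_of_le (by positivity)]
    norm_num
    linarith
  | succ J ih =>
    set s := (2 ^ J + 1 + J) * Real.log 2
    set e := (2 ^ (J + 1) - J) * Real.log 2 with he
    set s' := (2 ^ (J + 1) + 1 + ((J + 1 : ℕ) : ℝ)) * Real.log 2 with hs'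
    have hgap : s' - e = (2 * J + 2) * Real.log 2 := by rw [hs', he]; push_cast; ring
    have hcover : Ioc 0 s' \ ⋃ j, goodTimes j ⊆ (Ioc 0 s \ ⋃ j, goodTimes j) ∪ Icc e s' := by
      rintro t ⟨ht, hbad⟩
      by_cases hts : t ≤ s
      · exact Or.inl ⟨⟨ht.1, hts⟩, hbad⟩
      · refine Or.inr ⟨?_, ht.2⟩
        by_contra! hte
        exact hbad (mem_iUnion.2 ⟨J, (not_le.1 hts).le, hte.le⟩)
    have hfinite : volume (Ioc 0 s \ ⋃ j, goodTimes j) ≠ ⊤ :=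
      measure_ne_top_of_subset sdiff_subset measure_Ioc_lt_top.ne
    have hgap_le : volume.real (Icc e s') ≤ 2 * J + 2 := by
      rw [Real.volume_real_Icc_of_le (sub_nonneg.1 (hgap ▸ by positivity)), hgap]
      exact mul_le_of_le_one_right (by positivity) hlog
    refine (measureReal_mono hcover (measure_union_ne_top hfinite measure_Icc_lt_top.ne)).trans
      ((measureReal_union_le _ _).trans ((add_le_add ih hgap_le).trans ?_))
    push_cast
    linarith

theorem exists_nat_le_mul_log_two {T : ℝ} (hT : 1 ≤ T) :
    ∃ n : ℕ, T ≤ (2 ^ n + 1 + n) * Real.log 2 ∧ n ≤ 2 * Real.log T + 2 := by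
  have hlog2 : 1 / 2 ≤ Real.log 2 := by linarith [Real.log_two_gt_d9]
  have hlog2_pos : 0 < Real.log 2 := by positivity
  have hlogT := Real.log_nonneg hT
  set m := ⌈Real.log T / Real.log 2⌉₊
  refine ⟨m + 1, ?_, ?_⟩
  · have hpow : T ≤ 2 ^ m := by
      rw [two_pow_eq_exp, ← Real.log_le_iff_le_exp (one_pos.trans_le hT)]
      exact (div_le_iff₀ hlog2_pos).1 (Nat.le_ceil _)
    calc T ≤ 2 ^ (m + 1) * (1 / 2) := by rw [pow_succ]; linarith
      _ ≤ (2 ^ (m + 1) + 1 + (m + 1 : ℕ)) * Real.log 2 := by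
        gcongr
        linarith [Nat.cast_nonneg (α := ℝ) (m + 1)]
  · have hdiv : Real.log T / Real.log 2 ≤ 2 * Real.log T := by
      rw [div_le_iff₀ hlog2_pos]
      nlinarith
    push_cast
    linarith [Nat.ceil_lt_add_one (div_nonneg hlogT hlog2_pos.le)]

theorem tendsto_volume_sdiff_goodTimes_div :
    Tendsto (fun T : ℝ => volume.real (Ioc 0 T \ ⋃ j, goodTimes j) / T) atTop (𝓝 0) := by
  have hlog : ∀ n, Tendsto (fun T : ℝ => Real.log T ^ n / T) atTop (𝓝 0) := fun n =>
    (Real.isLittleO_pow_log_id_atTop (n := n)).tendsto_div_nhds_zero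
  have hlim : Tendsto (fun T : ℝ => (2 * Real.log T + 4) ^ 2 / T) atTop (𝓝 0) := by
    have := (((hlog 2).const_mul 4).add ((hlog 1).const_mul 16)).add ((hlog 0).const_mul 16)
    simp only [mul_zero, add_zero] at this
    refine this.congr fun T => ?_
    ring
  refine tendsto_of_tendsto_of_tendsto_of_le_of_le' tendsto_const_nhds hlim ?_ ?_
  · filter_upwards [eventually_gt_atTop 0] with T hT
    positivity
  · filter_upwards [eventually_ge_atTop 1] with T hT
    obtain ⟨n, hTn, hn⟩ := exists_nat_le_mul_log_two hT
    gcongr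
    calc volume.real (Ioc 0 T \ ⋃ j, goodTimes j)
        ≤ volume.real (Ioc 0 ((2 ^ n + 1 + n) * Real.log 2) \ ⋃ j, goodTimes j) :=
          measureReal_mono (sdiff_subset_sdiff_left (Ioc_subset_Ioc_right hTn))
            (measure_ne_top_of_subset sdiff_subset measure_Ioc_lt_top.ne)
      _ ≤ ((n : ℝ) + 2) ^ 2 := volume_sdiff_goodTimes_le n
      _ ≤ (2 * Real.log T + 4) ^ 2 := pow_le_pow_left₀ (by positivity) (by linarith) 2

theorem norm_setIntegral_le_add_of_norm_le_on_sdiff {X E : Type*} [MeasurableSpace X]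
    [NormedAddCommGroup E] [NormedSpace ℝ E] {μ : Measure X} {g : X → E} {s B : Set X} {C ε : ℝ}
    (hs : μ s ≠ ⊤) (hB : MeasurableSet B) (hg : IntegrableOn g s μ) (hε : 0 ≤ ε)
    (hC : ∀ x ∈ s ∩ B, ‖g x‖ ≤ C) (hgood : ∀ x ∈ s \ B, ‖g x‖ ≤ ε) :
    ‖∫ x in s, g x ∂μ‖ ≤ C * μ.real (s ∩ B) + ε * μ.real s := by
  have hbad_le : ‖∫ x in s ∩ B, g x ∂μ‖ ≤ C * μ.real (s ∩ B) :=
    norm_setIntegral_le_of_norm_le_const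
      (measure_ne_top_of_subset inter_subset_left hs).lt_top hC
  have hgood_le : ‖∫ x in s \ B, g x ∂μ‖ ≤ ε * μ.real s :=
    (norm_setIntegral_le_of_norm_le_const (measure_ne_top_of_subset sdiff_subset hs).lt_top
      hgood).trans (mul_le_mul_of_nonneg_left (measureReal_mono sdiff_subset hs) hε)
  rw [← integral_inter_add_sdiff hB hg]
  exact (norm_add_le _ _).trans (add_le_add hbad_le hgood_le)

section Average

variable {E : Type*} [NormedAddCommGroup E] [NormedSpace ℝ E] {h : ℝ → E} {C : ℝ} {L : E}
  {G : Set ℝ}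

theorem exists_norm_integral_sub_le (hcont : Continuous h) (hC : ∀ t, ‖h t - L‖ ≤ C)
    (hG : MeasurableSet G) (hlim : Tendsto h (atTop ⊓ 𝓟 G) (𝓝 L)) {ε : ℝ} (hε : 0 < ε) :
    ∃ K : ℝ, ∀ T ≥ 0,
      ‖∫ t in (0 : ℝ)..T, (h t - L)‖ ≤ C * (K + volume.real (Ioc 0 T \ G)) + ε * T := by
  have hclose : ∀ᶠ t in atTop, t ∈ G → ‖h t - L‖ ≤ ε := by
    rw [← eventually_inf_principal]
    exact (Metric.tendsto_nhds.1 hlim ε hε).mono fun t ht => (dist_eq_norm (h t) L ▸ ht).le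
  obtain ⟨K, hK0, hK⟩ :=
    ((eventually_ge_atTop (0 : ℝ)).and (eventually_forall_ge_atTop.2 hclose)).exists
  refine ⟨K, fun T hT => ?_⟩
  have hsub : Ioc 0 T ∩ (Iic K ∪ Gᶜ) ⊆ Ioc 0 K ∪ (Ioc 0 T \ G) := by
    rintro t ⟨ht, htK | htG⟩
    exacts [Or.inl ⟨ht.1, htK⟩, Or.inr ⟨ht, htG⟩]
  have hvolume : volume.real (Ioc 0 T ∩ (Iic K ∪ Gᶜ)) ≤ K + volume.real (Ioc 0 T \ G) := by
    refine (measureReal_mono hsub (measure_union_ne_top measure_Ioc_lt_top.ne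
      (measure_ne_top_of_subset sdiff_subset measure_Ioc_lt_top.ne))).trans
        ((measureReal_union_le _ _).trans_eq ?_)
    rw [Real.volume_real_Ioc_of_le hK0, sub_zero]
  have hint : IntegrableOn (fun t => h t - L) (Ioc 0 T) :=
    ((hcont.sub continuous_const).integrableOn_Icc).mono_set Ioc_subset_Icc_self
  have hbound := norm_setIntegral_le_add_of_norm_le_on_sdiff measure_Ioc_lt_top.ne
    (measurableSet_Iic.union hG.compl) hint hε.le (fun t _ => hC t) fun t ht => by
      obtain ⟨-, hbad⟩ := ht
      simp only [mem_union, mem_Iic, mem_compl_iff, not_or, not_le, not_not] at hbad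
      exact hK t hbad.1.le hbad.2
  rw [Real.volume_real_Ioc_of_le hT, sub_zero] at hbound
  rw [intervalIntegral.integral_of_le hT]
  exact hbound.trans (by gcongr; exact (norm_nonneg _).trans (hC 0))

theorem tendsto_average_of_tendsto_inf_principal [CompleteSpace E] (hcont : Continuous h)
    (hC : ∀ t, ‖h t - L‖ ≤ C) (hG : MeasurableSet G) (hlim : Tendsto h (atTop ⊓ 𝓟 G) (𝓝 L))
    (hdensity : Tendsto (fun T : ℝ => volume.real (Ioc 0 T \ G) / T) atTop (𝓝 0)) :
    Tendsto (fun T : ℝ => T⁻¹ • ∫ t in (0 : ℝ)..T, h t) atTop (𝓝 L) := by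
  refine Metric.tendsto_nhds.2 fun ε hε => ?_
  obtain ⟨K, hK⟩ := exists_norm_integral_sub_le hcont hC hG hlim (half_pos hε)
  have hbad : Tendsto (fun T : ℝ => C * (K / T + volume.real (Ioc 0 T \ G) / T)) atTop (𝓝 0) := by
    simpa only [add_zero, mul_zero, id] using
      ((tendsto_const_nhds.div_atTop tendsto_id).add hdensity).const_mul C
  filter_upwards [hbad.eventually_lt_const (half_pos hε), eventually_gt_atTop 0] with T hTbad hT
  have hsub : T⁻¹ • (∫ t in (0 : ℝ)..T, h t) - L = T⁻¹ • ∫ t in (0 : ℝ)..T, (h t - L) := by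
    rw [intervalIntegral.integral_sub (hcont.intervalIntegrable _ _) intervalIntegrable_const,
      intervalIntegral.integral_const, sub_zero, smul_sub, inv_smul_smul₀ hT.ne']
  calc dist (T⁻¹ • ∫ t in (0 : ℝ)..T, h t) L
      = T⁻¹ * ‖∫ t in (0 : ℝ)..T, (h t - L)‖ := by
        rw [dist_eq_norm, hsub, norm_smul, Real.norm_of_nonneg (inv_nonneg.2 hT.le)]
    _ ≤ T⁻¹ * (C * (K + volume.real (Ioc 0 T \ G)) + ε / 2 * T) := by gcongr; exact hK T hT.le
    _ = C * (K / T + volume.real (Ioc 0 T \ G) / T) + ε / 2 := by field_simp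
    _ < ε := by linarith

end Average

theorem generatesAt_codedPoint {w : BitPairSeq}
    (hw : ∀ᶠ j in atTop, codedPoint w ∈ centralPoints j) :
    GeneratesAt codedMeasure (codedPoint w) (lebesgueEFD 2) := by
  refine ⟨codedPoint_mem_support w, fun F => ?_⟩
  rw [integral_lebesgueEFD]
  have : CompactSpace (Metric.closedBall (0 : Fin 2 → ℝ) 1) :=
    isCompact_iff_compactSpace.1 (isCompact_closedBall 0 1)
  exact tendsto_average_of_tendsto_inf_principal
    (F.continuous.comp (continuous_scenery codedMeasure_eq_zero (codedPoint_mem_support w)))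
    (fun _ => (dist_eq_norm _ _).symm.trans_le (F.dist_le_two_norm _ _))
    (MeasurableSet.iUnion fun _ => measurableSet_Icc)
    ((F.continuous.tendsto _).comp (tendsto_scenery_goodTimes hw))
    tendsto_volume_sdiff_goodTimes_div

theorem isUSMGenerating_codedMeasure : IsUSMGenerating codedMeasure (lebesgueEFD 2) := by
  refine ⟨inferInstance, IsProbabilityMeasure.ne_zero _, ?_⟩
  filter_upwards [ae_mem_range_codedPoint, ae_eventually_mem_centralPoints]
  rintro _ ⟨w, rfl⟩ hw
  exact generatesAt_codedPoint hw

theorem mainTheorem12 :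
    -- smooth maps: a homogeneous set and a smooth map, injective on it, that lowers the dimension
    (IsHomogeneousSet cantorSquare ∧
      ∃ f : (Fin 2 → ℝ) → ℝ, ContDiff ℝ ∞ f ∧ InjOn f cantorSquare ∧
        dimH (f '' cantorSquare) < dimH cantorSquare ∧
        ∀ y ∈ f '' cantorSquare,
          dimH (f '' cantorSquare) + dimH (cantorSquare ∩ f ⁻¹' {y}) < dimH cantorSquare) ∧
    -- measures: a uniformly scaling measure of dimension above one with an injective projection
    (∃ (μ : ProbabilityMeasure (Fin 2 → ℝ)) (P : Measure (Measure (Fin 2 → ℝ))) (α : ℝ),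
      IsEFD P ∧ IsUSMGenerating (μ : Measure (Fin 2 → ℝ)) P ∧
      1 < α ∧ HasExactDim (μ : Measure (Fin 2 → ℝ)) α ∧ (∀ᵐ ν ∂P, HasExactDim ν α) ∧
      InjOn proj₁ (μ : Measure (Fin 2 → ℝ)).support ∧
      ∀ᵐ x ∂(μ : Measure (Fin 2 → ℝ)),
        upperDim ((μ : Measure (Fin 2 → ℝ)).map proj₁) +
          upperDim (fibreMeas (μ : Measure (Fin 2 → ℝ)) x) < (α : EReal)) := by
  refine ⟨⟨isHomogeneousSet_cantorSquare, exists_contDiff_injOn_dimH_lt⟩,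
    ⟨codedMeasure, inferInstance⟩, lebesgueEFD 2, 2, isEFD_lebesgueEFD 2,
    isUSMGenerating_codedMeasure, one_lt_two, hasExactDim_codedMeasure,
    ae_lebesgueEFD_iff.2 (by simpa using hasExactDim_normLebesgue 2),
    injOn_proj₁_range_codedPoint.mono support_codedMeasure_subset, ae_upperDim_add_lt⟩
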